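/- **Conventions.** Write $(c)_k=c(c+1)\cdots(c+k-1)$. Identify the set of point configurations (subsets) of $\mathbb Z_{\ge0}$ with $\{0,1\}^{\mathbb Z_{\ge0}}$, with its product topology and Borel $\sigma$-algebra. A probability measure $\mathbb P$ on configurations is *determinantal* with correlation kernel $K:\mathbb Z_{\ge0}\times\mathbb Z_{\ge0}\to\mathbb R$ if $\mathbb P(X\supseteq\{x_1,\dots,x_k\})=\det[K(x_i,x_j)]_{i,j=1}^k$ for all $k$ and all distinct $x_1,\dots,x_k\in\mathbb Z_{\ge0}$. *Discrete Jacobi ensemble.* For $a,b>-1$ and $r\in(-1,1)$, $\mathrm{DJ}^+(r;a,b)$ is the determinantal measure on configurations in $\mathbb Z_{\ge0}$ with kernel $$K(x,y)=\frac1{\|P_x\|\,\|P_y\|}\int_r^1P_x(t)P_y(t)(1-t)^a(1+t)^b\,dt,$$ where $P_n=P_n^{(a,b)}$ is the Jacobi polynomial $P_n(t)=\frac{(a+1)_n}{n!}\,{}_2F_1\!\left(-n,n+a+b+1;a+1;\tfrac{1-t}2\right)$ and $\|P_n\|^2=\int_{-1}^1P_n(t)^2(1-t)^a(1+t)^b\,dt$.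 *Racah ensemble.* Let $M$ be a positive integer, $\alpha=-M-1$, $\gamma,\delta>-1$, $\beta>M+\gamma$, and $1\le N\le M$. $\mathrm{Racah}(N,\alpha,\beta,\gamma,\delta)$ is the determinantal measure on configurations in $\{0,\dots,M\}\subset\mathbb Z_{\ge0}$ with kernel $$K_N(x,y)=(W(x)W(y))^{1/2}\sum_{n=0}^{N-1}\frac{R_n(x)R_n(y)}{\|R_n\|^2}\quad(0\le x,y\le M),$$ extended by $0$ to all other $(x,y)\in\mathbb Z_{\ge0}^2$, where $$W(x)=\frac{(\alpha+1)_x(\beta+\delta+1)_x(\gamma+1)_x(\gamma+\delta+1)_x\left(\frac{\gamma+\delta+3}2\right)_x}{(-\alpha+\gamma+\delta+1)_x(-\beta+\gamma+1)_x\left(\frac{\gamma+\delta+1}2\right)_x(\delta+1)_x\,x!}$$ (with its limiting value when $\gamma+\delta+1=0$), $\|R_n\|^2=\sum_{x=0}^MW(x)R_n(x)^2$, and $R_n$ is the Racah polynomial $$R_n(x)=\sum_{k=0}^{n}\frac{(-n)_k(n+\alpha+\beta+1)_k(-x)_k(x+\gamma+\delta+1)_k}{(\alpha+1)_k(\beta+\delta+1)_k(\gamma+1)_k\,k!},$$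 which is a polynomial of degree $n$ in $x(x+\gamma+\delta+1)$. **Theorem.** Fix $a>-1$, $b>-1$, $r\in(-1,1)$ and $c>0$. Let the positive integers $N$ and $M$ tend to infinity (along a sequence) in such a way that $$\frac NM\to\sqrt{\frac{1-r}2},$$ and put $\gamma=a$, $\delta=b$, $\alpha=-M-1$, $\beta=M+a+c$. Then $N\le M$ eventually, all the ensembles involved exist and are uniquely determined by their correlation kernels, and the Racah ensembles $\mathrm{Racah}(N,\alpha,\beta,\gamma,\delta)$ converge weakly, as probability measures on $\{0,1\}^{\mathbb Z_{\ge0}}$, to the discrete Jacobi ensemble $\mathrm{DJ}^+(r;a,b)$. -/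

import Mathlib

open MeasureTheory Filter Topology

noncomputable section

/-! # Determinantal point processes on the nonnegative integers -/

/-- The space of point configurations in `ℤ_{≥0}`, i.e. of all subsets `X ⊆ ℤ_{≥0}`, a subset being
identified with its indicator function (`X x = true` means that `x` belongs to the configuration).
It carries the product topology (compact, totally disconnected) and its Borel σ-algebra. -/
abbrev Conf : Type := ℕ → Bool

/-- The cylinder set `C_Y` of all configurations containing the finite set `Y`. -/
def cylinderSet (Y : Finset ℕ) : Set Conf := {X | ∀ x ∈ Y, X x = true}

/-- `P` is the determinantal measure with correlation kernel `K` with respect to the counting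
measure: for every finite set `Y = {x₁, …, x_k}` of distinct points, the correlation function
`ρ_k(x₁, …, x_k) = P(C_Y)` equals `det [K(x_i, x_j)]`. -/
def IsDeterminantal (K : ℕ → ℕ → ℝ) (P : ProbabilityMeasure Conf) : Prop :=
  ∀ Y : Finset ℕ, (P : Measure Conf).real (cylinderSet Y) =
    (Matrix.of fun i j : Y => K (i : ℕ) (j : ℕ)).det

/-- The Pochhammer symbol `(c)_k = c (c + 1) ⋯ (c + k - 1)`. -/
def poch (c : ℝ) (k : ℕ) : ℝ := (ascPochhammer ℝ k).eval c

/-! # The discrete Jacobi ensemble `DJ⁺(r; a, b)` -/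

/-- The Jacobi polynomial
`P_n^{(a,b)}(t) = ((a+1)_n / n!) ₂F₁(-n, n+a+b+1; a+1; (1-t)/2)`. -/
def jacobiPoly (a b : ℝ) (n : ℕ) (t : ℝ) : ℝ :=
  poch (a + 1) n / (n.factorial : ℝ) *
    ∑ k ∈ Finset.range (n + 1),
      poch (-(n : ℝ)) k * poch ((n : ℝ) + a + b + 1) k / (poch (a + 1) k * (k.factorial : ℝ)) *
        ((1 - t) / 2) ^ k

/-- The Jacobi weight `(1-t)^a (1+t)^b` on `(-1, 1)`. -/
def jacobiWeight (a b t : ℝ) : ℝ := (1 - t) ^ a * (1 + t) ^ b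

/-- The norm of `P_n^{(a,b)}` in `L²((-1,1), (1-t)^a (1+t)^b dt)`. -/
def jacobiNorm (a b : ℝ) (n : ℕ) : ℝ :=
  Real.sqrt (∫ t in (-1 : ℝ)..1, jacobiPoly a b n t ^ 2 * jacobiWeight a b t)

/-- The discrete Jacobi kernel
`K(x, y) = (‖P_x‖ ‖P_y‖)⁻¹ ∫_r^1 P_x(t) P_y(t) (1-t)^a (1+t)^b dt` of `DJ⁺(r; a, b)`. -/
def discreteJacobiKernel (r a b : ℝ) (x y : ℕ) : ℝ :=
  1 / (jacobiNorm a b x * jacobiNorm a b y) *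
    ∫ t in r..1, jacobiPoly a b x t * jacobiPoly a b y t * jacobiWeight a b t

/-- `P` is the discrete Jacobi ensemble `DJ⁺(r; a, b)`. -/
def IsDiscreteJacobiEnsemble (r a b : ℝ) (P : ProbabilityMeasure Conf) : Prop :=
  IsDeterminantal (discreteJacobiKernel r a b) P

/-! # The Racah ensembles -/

/-- The factor `(s+1)_x ((s+3)/2)_x / ((s+1)/2)_x` of the Racah weight, `s = γ + δ > -2`, written
after cancellation of the common factor `s + 1`, so that the removable singularity at `s = -1` is
filled in by continuity: it is `1` at `x = 0`, and `(s+2)_{x-1} (2x+s+1)` for `x ≥ 1`.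
See `racahFactor_eq` and `continuous_racahFactor`. -/
def racahFactor (s : ℝ) : ℕ → ℝ
  | 0 => 1
  | x + 1 => poch (s + 2) x * (2 * ((x : ℝ) + 1) + s + 1)

/-- The Racah weight
`W(x) = (α+1)_x (β+δ+1)_x (γ+1)_x (γ+δ+1)_x ((γ+δ+3)/2)_x /
  ((-α+γ+δ+1)_x (-β+γ+1)_x ((γ+δ+1)/2)_x (δ+1)_x x!)`. -/
def racahWeight (α β γ δ : ℝ) (x : ℕ) : ℝ :=
  poch (α + 1) x * poch (β + δ + 1) x * poch (γ + 1) x * racahFactor (γ + δ) x /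
    (poch (-α + γ + δ + 1) x * poch (-β + γ + 1) x * poch (δ + 1) x * (x.factorial : ℝ))

/-- The `n`th Racah polynomial, as a function of `x ∈ {0, …, M}` (where `α + 1 = -M`, `n ≤ M`):
`₄F₃(-n, n+α+β+1, -x, x+γ+δ+1; α+1, β+δ+1, γ+1; 1)`,
a polynomial of degree `n` in `x (x+γ+δ+1)`. -/
def racahPoly (α β γ δ : ℝ) (n x : ℕ) : ℝ :=
  ∑ k ∈ Finset.range (n + 1),
    poch (-(n : ℝ)) k * poch ((n : ℝ) + α + β + 1) k * poch (-(x : ℝ)) k *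
        poch ((x : ℝ) + γ + δ + 1) k /
      (poch (α + 1) k * poch (β + δ + 1) k * poch (γ + 1) k * (k.factorial : ℝ))

/-- The squared norm of the `n`th Racah polynomial in `L²({0, …, M}, W)`. -/
def racahNormSq (M : ℕ) (α β γ δ : ℝ) (n : ℕ) : ℝ :=
  ∑ x ∈ Finset.range (M + 1), racahWeight α β γ δ x * racahPoly α β γ δ n x ^ 2

/-- The correlation kernel (with respect to the counting measure) of the `N`-particle Racah
ensemble, `(W(x) W(y))^{1/2} ∑_{n < N} R_n(x) R_n(y) / ‖R_n‖²` for `x, y ∈ {0, …, M}`, extended by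
zero to `ℤ_{≥0} × ℤ_{≥0}`. -/
def racahKernel (N M : ℕ) (α β γ δ : ℝ) (x y : ℕ) : ℝ :=
  if x ≤ M ∧ y ≤ M then
    Real.sqrt (racahWeight α β γ δ x * racahWeight α β γ δ y) *
      ∑ n ∈ Finset.range N,
        racahPoly α β γ δ n x * racahPoly α β γ δ n y / racahNormSq M α β γ δ n
  else 0

/-- `P` is the `N`-particle Racah ensemble `Racah(N, α, β, γ, δ)`, `α = -M-1`, regarded as a point
process on `ℤ_{≥0} ⊇ {0, …, M}`. -/
def IsRacahEnsemble (N M : ℕ) (β γ δ : ℝ) (P : ProbabilityMeasure Conf) : Prop :=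
  IsDeterminantal (racahKernel N M (-(M : ℝ) - 1) β γ δ) P

/-- `racahFactor s` is the factor in the usual formula whenever that formula makes sense. -/
theorem racahFactor_eq (s : ℝ) (hs : -2 < s) (hs1 : s + 1 ≠ 0) (x : ℕ) :
    racahFactor s x = poch (s + 1) x * poch ((s + 3) / 2) x / poch ((s + 1) / 2) x := by
  have h2 : ∀ x : ℕ, poch ((s + 1) / 2) x ≠ 0 := by
    intro x
    induction x with
    | zero => simp [poch]
    | succ n ih =>
      have e : poch ((s + 1) / 2) (n + 1) = poch ((s + 1) / 2) n * ((s + 1) / 2 + n) := by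
        simp [poch, ascPochhammer_succ_eval]
      rw [e]
      refine mul_ne_zero ih ?_
      rcases Nat.eq_zero_or_pos n with rfl | hn
      · simpa using hs1
      · have : (1 : ℝ) ≤ n := by exact_mod_cast hn
        intro h
        linarith
  have h1 : ∀ x : ℕ, poch (s + 1) (x + 1) = (s + 1) * poch (s + 2) x := by
    intro x
    induction x with
    | zero => simp [poch]
    | succ n ih =>
      have e : poch (s + 1) (n + 1 + 1) = poch (s + 1) (n + 1) * (s + 1 + (n + 1)) := by
        simp [poch, ascPochhammer_succ_eval]
      have e' : poch (s + 2) (n + 1) = poch (s + 2) n * (s + 2 + n) := by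
        simp [poch, ascPochhammer_succ_eval]
      rw [e, e', ih]
      ring
  have h3 : ∀ x : ℕ, poch ((s + 3) / 2) x * (s + 1) = (2 * x + s + 1) * poch ((s + 1) / 2) x := by
    intro x
    induction x with
    | zero => simp [poch]
    | succ n ih =>
      have e : poch ((s + 3) / 2) (n + 1) = poch ((s + 3) / 2) n * ((s + 3) / 2 + n) := by
        simp [poch, ascPochhammer_succ_eval]
      have e' : poch ((s + 1) / 2) (n + 1) = poch ((s + 1) / 2) n * ((s + 1) / 2 + n) := by
        simp [poch, ascPochhammer_succ_eval]
      rw [e, e']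
      push_cast
      linear_combination ((s + 3) / 2 + n) * ih
  cases x with
  | zero => simp [racahFactor, poch]
  | succ n =>
    rw [eq_div_iff (h2 _), racahFactor, h1]
    have := h3 (n + 1)
    push_cast at this
    linear_combination (-poch (s + 2) n) * this

/-- The factor depends continuously on `s`, so its value at `s = -1` is the limiting one. -/
theorem continuous_racahFactor (x : ℕ) : Continuous fun s => racahFactor s x := by
  cases x with
  | zero => exact continuous_const
  | succ n =>
    simp only [racahFactor, poch]
    have := (ascPochhammer ℝ n).continuous
    fun_prop

end

noncomputable section

/-! ### Determinantal measures are determined by their kernels -/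

theorem isClopen_cylinderSet (Y : Finset ℕ) : IsClopen (cylinderSet Y) := by
  have : cylinderSet Y = ⋂ x ∈ Y, (fun X : Conf => X x) ⁻¹' {true} := by
    ext X; simp [cylinderSet]
  rw [this]
  exact isClopen_biInter_finset fun x _ => (isClopen_discrete _).preimage (continuous_apply x)

theorem isPiSystem_cylinderSet : IsPiSystem (Set.range cylinderSet) := by
  rintro _ ⟨Y, rfl⟩ _ ⟨Z, rfl⟩ _
  refine ⟨Y ∪ Z, ?_⟩
  ext X
  simp only [cylinderSet, Finset.mem_union, Set.mem_ofPred_eq, Set.mem_inter_iff]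
  grind

theorem generateFrom_cylinderSet :
    (inferInstance : MeasurableSpace Conf) =
      MeasurableSpace.generateFrom (Set.range cylinderSet) := by
  apply le_antisymm
  · refine iSup_le fun x => ?_
    rw [← measurable_iff_comap_le]
    refine @measurable_to_bool Conf (MeasurableSpace.generateFrom (Set.range cylinderSet)) _ ?_
    refine MeasurableSpace.measurableSet_generateFrom ⟨{x}, ?_⟩
    ext X
    simp [cylinderSet]
  · refine MeasurableSpace.generateFrom_le ?_
    rintro _ ⟨Y, rfl⟩
    exact (isClopen_cylinderSet Y).isOpen.measurableSet

theorem IsDeterminantal.eq {K : ℕ → ℕ → ℝ} {P Q : ProbabilityMeasure Conf}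
    (hP : IsDeterminantal K P) (hQ : IsDeterminantal K Q) : P = Q := by
  apply Subtype.ext
  have : IsFiniteMeasure P.val := inferInstanceAs (IsFiniteMeasure (P : Measure Conf))
  refine ext_of_generate_finite _ generateFrom_cylinderSet isPiSystem_cylinderSet ?_
    (P.2.measure_univ.trans Q.2.measure_univ.symm)
  rintro _ ⟨Y, rfl⟩
  have : (P : Measure Conf).real (cylinderSet Y) = (Q : Measure Conf).real (cylinderSet Y) := by
    rw [hP Y, hQ Y]
  have hQ' : IsFiniteMeasure Q.val := inferInstanceAs (IsFiniteMeasure (Q : Measure Conf))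
  exact (measureReal_eq_measureReal_iff (measure_ne_top _ _) (measure_ne_top _ _)).1 this

theorem tendsto_real_cylinderSet {ι : Type*} {l : Filter ι} {P : ι → ProbabilityMeasure Conf}
    {Q : ProbabilityMeasure Conf} (h : Tendsto P l (𝓝 Q)) (Y : Finset ℕ) :
    Tendsto (fun i => (P i : Measure Conf).real (cylinderSet Y)) l
      (𝓝 ((Q : Measure Conf).real (cylinderSet Y))) := by
  have := ProbabilityMeasure.tendsto_measure_of_isClopen_of_tendsto h (isClopen_cylinderSet Y)
  exact (NNReal.continuous_coe.tendsto _).comp this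

/-- A limit of determinantal measures whose kernels converge pointwise is determinantal. -/
theorem IsDeterminantal.of_tendsto {ι : Type*} {l : Filter ι} [l.NeBot]
    {P : ι → ProbabilityMeasure Conf} {Q : ProbabilityMeasure Conf}
    {k : ι → ℕ → ℕ → ℝ} {K : ℕ → ℕ → ℝ} (hk : ∀ x y, Tendsto (fun i => k i x y) l (𝓝 (K x y)))
    (hP : ∀ᶠ i in l, IsDeterminantal (k i) (P i)) (hQ : Tendsto P l (𝓝 Q)) :
    IsDeterminantal K Q := by
  intro Y
  have h1 := tendsto_real_cylinderSet hQ Y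
  have h2 : Tendsto (fun i => (Matrix.of fun u v : Y => k i u v).det) l
      (𝓝 (Matrix.of fun u v : Y => K u v).det) := by
    refine ((Continuous.matrix_det continuous_id).tendsto _).comp ?_
    exact tendsto_pi_nhds.2 fun u => tendsto_pi_nhds.2 fun v => hk u v
  refine tendsto_nhds_unique h1 (h2.congr' ?_)
  filter_upwards [hP] with i hi
  exact (hi Y).symm

theorem IsDeterminantal.tendsto {k : ℕ → ℕ → ℕ → ℝ} {K : ℕ → ℕ → ℝ}
    (hk : ∀ x y, Tendsto (fun i => k i x y) atTop (𝓝 (K x y)))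
    {P : ℕ → ProbabilityMeasure Conf} {Q : ProbabilityMeasure Conf}
    (hP : ∀ᶠ i in atTop, IsDeterminantal (k i) (P i)) (hQ : IsDeterminantal K Q) :
    Tendsto P atTop (𝓝 Q) := by
  refine tendsto_nhds_of_unique_mapClusterPt fun Q' hQ' => ?_
  obtain ⟨U, hU, hUQ⟩ := mapClusterPt_iff_ultrafilter.1 hQ'
  exact (IsDeterminantal.of_tendsto (fun x y => (hk x y).mono_left hU) (hU hP) hUQ).eq hQ

theorem exists_isDeterminantal_of_tendsto {k : ℕ → ℕ → ℕ → ℝ} {K : ℕ → ℕ → ℝ}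
    (hk : ∀ x y, Tendsto (fun i => k i x y) atTop (𝓝 (K x y)))
    (hP : ∀ᶠ i in atTop, ∃ P, IsDeterminantal (k i) P) : ∃ Q, IsDeterminantal K Q := by
  obtain ⟨P₀, -⟩ := hP.exists.choose_spec
  have : ∀ i, ∃ P, (∃ P', IsDeterminantal (k i) P') → IsDeterminantal (k i) P := fun i => by
    by_cases h : ∃ P', IsDeterminantal (k i) P'
    · exact ⟨h.choose, fun _ => h.choose_spec⟩
    · exact ⟨⟨Measure.dirac fun _ => true, inferInstance⟩, fun h' => (h h').elim⟩
  choose P hP' using this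
  obtain ⟨Q, hQ⟩ := exists_clusterPt_of_compactSpace (map P atTop)
  obtain ⟨U, hU, hUQ⟩ := mapClusterPt_iff_ultrafilter.1 (show MapClusterPt Q atTop P from hQ)
  exact ⟨Q, IsDeterminantal.of_tendsto (fun x y => (hk x y).mono_left hU)
    (hU (hP.mono hP')) hUQ⟩

/-! ### Determinantal measures of orthogonal projections -/

section Projection

variable {ι : Type*} [DecidableEq ι]

/-- The matrix whose rows in `S` are those of `A` and whose other rows are those of `B`. -/
def rowPiecewise (S : Finset ι) (A B : Matrix ι ι ℝ) : Matrix ι ι ℝ :=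
  Matrix.of fun i j => if i ∈ S then A i j else B i j

theorem rowPiecewise_eq (S : Finset ι) (A B : Matrix ι ι ℝ) :
    rowPiecewise S A B = S.piecewise (fun i => A i) (fun i => B i) := by
  ext i j
  by_cases hi : i ∈ S <;> simp [rowPiecewise, Finset.piecewise, hi]

variable [Fintype ι]

theorem det_rowPiecewise_one (A : Matrix ι ι ℝ) (T : Finset ι) :
    (rowPiecewise T A 1).det =
      (A.submatrix (fun i : T => (i : ι)) (fun i : T => (i : ι))).det := by
  rw [Matrix.twoBlockTriangular_det _ (fun i => i ∈ T)]
  · have h1 : (rowPiecewise T A 1).toSquareBlockProp (fun i => i ∉ T)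
        = 1 := by
      ext i j
      simp [Matrix.toSquareBlockProp, Matrix.one_apply, rowPiecewise, i.2, Subtype.ext_iff]
    have h2 : (rowPiecewise T A 1).toSquareBlockProp (fun i => i ∈ T)
        = A.submatrix (fun i : {i // i ∈ T} => (i : ι)) (fun i : {i // i ∈ T} => (i : ι)) := by
      ext i j
      simp [Matrix.toSquareBlockProp, rowPiecewise, i.2]
    rw [h1, h2, Matrix.det_one, mul_one]
    congr!
  · intro i hi j hj
    have : i ≠ j := fun h => hi (h ▸ hj)
    simp [rowPiecewise, hi, this]

/-- The probability of the configuration `S` under the determinantal measure with kernel `K`. -/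
def projWeight (K : Matrix ι ι ℝ) (S : Finset ι) : ℝ :=
  (rowPiecewise S K (1 - K)).det

theorem sum_projWeight (K : Matrix ι ι ℝ) (T : Finset ι) :
    ∑ S : Finset ι, (if T ⊆ S then projWeight K S else 0) =
      (K.submatrix (fun i : T => (i : ι)) (fun i : T => (i : ι))).det := by
  rw [← det_rowPiecewise_one]
  have key := (Matrix.detRowAlternating (R := ℝ) (n := ι)).toMultilinearMap.map_add_univ
    K (rowPiecewise T 0 (1 - K))
  have h1 : K + rowPiecewise T 0 (1 - K) =
      rowPiecewise T K 1 := by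
    ext i j
    by_cases hi : i ∈ T <;> simp [rowPiecewise, hi]
  change Matrix.det (K + rowPiecewise T 0 (1 - K)) = ∑ S : Finset ι, Matrix.det _ at key
  rw [h1] at key
  refine Eq.trans ?_ key.symm
  refine Finset.sum_congr rfl fun S _ => ?_
  split_ifs with h
  · refine congrArg Matrix.det ?_
    rw [rowPiecewise_eq]
    ext i j
    by_cases hi : i ∈ S
    · simp [Finset.piecewise, hi]
    · have hT : i ∉ T := fun hT => hi (h hT)
      simp [rowPiecewise, Finset.piecewise, hi, hT]
  · obtain ⟨i, hiT, hiS⟩ := Finset.not_subset.1 h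
    refine (Matrix.det_eq_zero_of_row_eq_zero i fun j => ?_).symm
    simp [rowPiecewise, Finset.piecewise, hiS, hiT]

theorem projWeight_nonneg {K : Matrix ι ι ℝ} (hs : K.transpose = K) (hK : K * K = K)
    (S : Finset ι) : 0 ≤ projWeight K S := by
  have hp : K.PosSemidef := by
    have := Matrix.posSemidef_conjTranspose_mul_self K
    rwa [Matrix.conjTranspose_eq_transpose_of_trivial, hs, hK] at this
  have hq : (1 - K).PosSemidef := by
    have := Matrix.posSemidef_conjTranspose_mul_self (1 - K)
    rw [Matrix.conjTranspose_eq_transpose_of_trivial, Matrix.transpose_sub, hs,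
      Matrix.transpose_one] at this
    have e : (1 - K) * (1 - K) = 1 - K := by
      rw [mul_sub, sub_mul, sub_mul, hK]; simp
    rwa [e] at this
  have pos : ∀ t ∈ Set.Ioo (0 : ℝ) 1,
      0 ≤ (rowPiecewise S (t • K) (1 - t • K)).det := by
    intro t ht
    have ht' : 0 < 1 - t := sub_pos.2 ht.2
    have e : rowPiecewise S (t • K) (1 - t • K) =
        rowPiecewise S ((t / (1 - t)) • K) 1 * (1 - t • K) := by
      have hL : ((t / (1 - t)) • K) * (1 - t • K) = t • K := by
        rw [mul_sub, mul_one, Matrix.smul_mul, Matrix.mul_smul, hK, ← smul_sub]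
        have : K - t • K = (1 - t) • K := by rw [sub_smul, one_smul]
        rw [this, smul_smul, div_mul_cancel₀ _ ht'.ne']
      ext i j
      by_cases hi : i ∈ S
      · have := congrFun (congrFun hL i) j
        simp only [Matrix.mul_apply] at this ⊢
        simpa [rowPiecewise, hi] using this.symm
      · have := congrFun (congrFun (Matrix.one_mul (1 - t • K)) i) j
        simp only [Matrix.mul_apply] at this ⊢
        simpa [rowPiecewise, hi] using this.symm
    rw [e, Matrix.det_mul]
    refine mul_nonneg ?_ ?_
    · rw [det_rowPiecewise_one]
      have : ((t / (1 - t)) • K).PosSemidef := hp.smul (div_nonneg ht.1.le ht'.le)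
      exact (this.submatrix _).det_nonneg
    · have : 1 - t • K = (1 - K) + (1 - t) • K := by
        rw [sub_smul, one_smul]; abel
      rw [this]
      exact (hq.add (hp.smul ht'.le)).det_nonneg
  have cont : Tendsto (fun t : ℝ => (rowPiecewise S (t • K) (1 - t • K)).det)
      (𝓝[<] 1) (𝓝 (projWeight K S)) := by
    have hc : Continuous fun t : ℝ => (rowPiecewise S (t • K) (1 - t • K)).det := by
      refine Continuous.matrix_det (continuous_matrix fun i j => ?_)
      by_cases hi : i ∈ S
      · simp only [rowPiecewise, hi, Matrix.of_apply, if_true, Matrix.smul_apply]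
        fun_prop
      · simp only [rowPiecewise, hi, Matrix.of_apply, if_false, Matrix.sub_apply,
          Matrix.smul_apply]
        fun_prop
    have := (hc.tendsto 1).mono_left (nhdsWithin_le_nhds (s := Set.Iio 1))
    simpa [projWeight] using this
  refine ge_of_tendsto cont ?_
  filter_upwards [Ioo_mem_nhdsLT (zero_lt_one (α := ℝ))] with t ht using pos t ht

/-- The kernel of an orthogonal projection on a finite set, extended by zero to `ℕ`, is the
correlation kernel of a determinantal measure. -/
theorem exists_isDeterminantal_of_projection {K : Matrix ι ι ℝ} (hs : K.transpose = K)
    (hK : K * K = K) (e : ι ↪ ℕ) (k : ℕ → ℕ → ℝ) (hk : ∀ i j, k (e i) (e j) = K i j)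
    (hk0 : ∀ x y, x ∉ Set.range e → k x y = 0) : ∃ P, IsDeterminantal k P := by
  have hsum : ∑ S : Finset ι, projWeight K S = 1 := by
    simpa using sum_projWeight K ∅
  let conf : Finset ι → Conf := fun S x => decide (x ∈ S.map e)
  let μ : Measure Conf := ∑ S : Finset ι, ENNReal.ofReal (projWeight K S) • Measure.dirac (conf S)
  have hμ : ∀ E : Set Conf, MeasurableSet E →
      μ E = ENNReal.ofReal (∑ S : Finset ι, E.indicator (fun _ => projWeight K S) (conf S)) := by
    intro E hE
    rw [ENNReal.ofReal_sum_of_nonneg fun S _ =>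
      Set.indicator_nonneg (fun _ _ => projWeight_nonneg hs hK S) _]
    simp only [μ, Measure.coe_finsetSum, Finset.sum_apply, Measure.smul_apply, smul_eq_mul,
      Measure.dirac_apply' _ hE]
    refine Finset.sum_congr rfl fun S _ => ?_
    by_cases h : conf S ∈ E <;> simp [h]
  have hprob : IsProbabilityMeasure μ := ⟨by
    rw [hμ _ MeasurableSet.univ]; simp [hsum]⟩
  refine ⟨⟨μ, hprob⟩, fun Y => ?_⟩
  rw [Measure.real, ProbabilityMeasure.coe_mk, hμ _ (isClopen_cylinderSet Y).isOpen.measurableSet,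
    ENNReal.toReal_ofReal (Finset.sum_nonneg fun S _ =>
      Set.indicator_nonneg (fun _ _ => projWeight_nonneg hs hK S) _)]
  have hmem : ∀ S, conf S ∈ cylinderSet Y ↔ Y ⊆ S.map e := fun S => by
    simp [conf, cylinderSet, Finset.subset_iff]
  classical
  simp only [Set.indicator_apply, hmem]
  by_cases hY : ∃ x ∈ Y, x ∉ Set.range e
  · obtain ⟨x, hx, hxe⟩ := hY
    rw [Matrix.det_eq_zero_of_row_eq_zero ⟨x, hx⟩ fun j => by simp [hk0 x j hxe]]
    refine Finset.sum_eq_zero fun S _ => if_neg fun h => hxe ?_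
    obtain ⟨i, -, hi⟩ := Finset.mem_map.1 (h hx)
    exact ⟨i, hi⟩
  · push Not at hY
    obtain ⟨T, rfl⟩ : ∃ T : Finset ι, Y = T.map e := by
      refine ⟨Finset.univ.filter fun i => e i ∈ Y, ?_⟩
      ext x
      simp only [Finset.mem_map, Finset.mem_filter, Finset.mem_univ, true_and]
      constructor
      · intro hx
        obtain ⟨i, rfl⟩ := hY x hx
        exact ⟨i, hx, rfl⟩
      · rintro ⟨i, hi, rfl⟩
        exact hi
    have hsub : ∀ S : Finset ι, T.map e ⊆ S.map e ↔ T ⊆ S := fun S => Finset.map_subset_map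
    simp only [hsub]
    rw [sum_projWeight]
    let e' : T ≃ T.map e := Equiv.ofBijective
      (fun i => ⟨e i, Finset.mem_map_of_mem e i.2⟩)
      ⟨fun i j h => Subtype.ext (e.injective (congrArg Subtype.val h)), fun x => by
        obtain ⟨i, hi, hx⟩ := Finset.mem_map.1 x.2
        exact ⟨⟨i, hi⟩, Subtype.ext hx⟩⟩
    rw [← Matrix.det_submatrix_equiv_self e']
    congr 1
    ext i j
    exact (hk i j).symm

end Projection

/-! ### Pochhammer symbols -/

theorem poch_zero (c : ℝ) : poch c 0 = 1 := by simp [poch]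

theorem poch_succ (c : ℝ) (k : ℕ) : poch c (k + 1) = poch c k * (c + k) := by
  simp [poch, ascPochhammer_succ_eval]

theorem poch_succ_left (c : ℝ) (k : ℕ) : poch c (k + 1) = c * poch (c + 1) k := by
  simp [poch, ascPochhammer_succ_left, Polynomial.eval_comp]

theorem poch_pos {c : ℝ} (hc : 0 < c) (k : ℕ) : 0 < poch c k := ascPochhammer_pos k c hc

theorem poch_ne_zero {c : ℝ} {k : ℕ} (h : ∀ j < k, c + j ≠ 0) : poch c k ≠ 0 := by
  induction k with
  | zero => simp [poch_zero]
  | succ k ih =>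
    rw [poch_succ]
    exact mul_ne_zero (ih fun j hj => h j (by omega)) (h k (by omega))

theorem poch_neg_eq_zero {n k : ℕ} (h : n < k) : poch (-(n : ℝ)) k = 0 := by
  induction k with
  | zero => omega
  | succ k ih =>
    rw [poch_succ]
    rcases Nat.lt_succ_iff_lt_or_eq.1 h with h | rfl
    · rw [ih h, zero_mul]
    · simp

theorem poch_neg_div_pos {c d : ℝ} {k : ℕ} (h : ∀ j < k, c + j < 0 ∧ d + j < 0) :
    0 < poch c k / poch d k := by
  induction k with
  | zero => simp [poch_zero]
  | succ k ih =>
    rw [poch_succ, poch_succ, mul_div_mul_comm]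
    exact mul_pos (ih fun j hj => h j (by omega))
      (div_pos_of_neg_of_neg (h k (by omega)).1 (h k (by omega)).2)

/-! ### The Racah difference equation -/

/-- The basis `(-x)_k (x+s+1)_k` of the polynomials in `x (x+s+1)`. -/
def racahBasis (s : ℝ) (k x : ℕ) : ℝ := poch (-(x : ℝ)) k * poch (x + s + 1) k

/-- The coefficient of `f (x + 1) - f x` in the Racah difference operator. -/
def racahUp (α β γ δ : ℝ) (x : ℕ) : ℝ :=
  if x = 0 then (α + 1) * (β + δ + 1) * (γ + 1) / (γ + δ + 2)
  else (x + α + 1) * (x + β + δ + 1) * (x + γ + 1) * (x + (γ + δ) + 1) /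
    ((2 * x + (γ + δ) + 1) * (2 * x + (γ + δ) + 2))

/-- The coefficient of `f (x - 1) - f x` in the Racah difference operator. -/
def racahDown (α β γ δ : ℝ) (x : ℕ) : ℝ :=
  x * (x - α + (γ + δ)) * (x - β + γ) * (x + δ) /
    ((2 * x + (γ + δ)) * (2 * x + (γ + δ) + 1))

/-- The Racah difference operator. -/
def racahOp (α β γ δ : ℝ) (f : ℕ → ℝ) (x : ℕ) : ℝ :=
  racahUp α β γ δ x * (f (x + 1) - f x) + racahDown α β γ δ x * (f (x - 1) - f x)

theorem racahOp_basis_zero (α β γ δ : ℝ) (x : ℕ) :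
    racahOp α β γ δ (racahBasis (γ + δ) 0) x = 0 := by
  simp [racahOp, racahBasis, poch_zero]

theorem racahBasis_up (s : ℝ) (k x : ℕ) :
    (x + s + 1) * (racahBasis s (k + 1) (x + 1) - racahBasis s (k + 1) x) =
      -((k + 1) * (2 * x + s + 2) * (x + s + 1 + k)) * racahBasis s k x := by
  have h1 : poch (-((x + 1 : ℕ) : ℝ)) (k + 1) = (-(x : ℝ) - 1) * poch (-(x : ℝ)) k := by
    rw [poch_succ_left]; push_cast; ring_nf
  have h2 : (x + s + 1) * poch ((x : ℝ) + s + 2) k = poch (x + s + 1) k * (x + s + 1 + k) := by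
    rw [← poch_succ, poch_succ_left]; ring_nf
  have h3 : poch (((x + 1 : ℕ) : ℝ) + s + 1) (k + 1) =
      poch ((x : ℝ) + s + 2) k * (x + s + 2 + k) := by
    rw [poch_succ]; push_cast; ring_nf
  simp only [racahBasis]
  rw [h1, h3, poch_succ, poch_succ]
  linear_combination (-(x : ℝ) - 1) * poch (-(x : ℝ)) k * (x + s + 2 + k) * h2

theorem racahBasis_down (s : ℝ) (k x : ℕ) :
    ((x : ℝ) + 1) * (racahBasis s (k + 1) x - racahBasis s (k + 1) (x + 1)) =
      ((k + 1) * (2 * x + 2 + s) * (x + 1 - k)) * racahBasis s k (x + 1) := by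
  have h2 : -((x : ℝ) + 1) * poch (-(x : ℝ)) k =
      poch (-((x : ℝ) + 1)) k * (-(x + 1) + k) := by
    rw [← poch_succ, poch_succ_left]; ring_nf
  have h3 : poch ((x : ℝ) + s + 1) (k + 1) = (x + s + 1) * poch ((x : ℝ) + 1 + s + 1) k := by
    rw [poch_succ_left]; ring_nf
  have h4 : poch (-(x : ℝ)) (k + 1) = poch (-(x : ℝ)) k * (-x + k) := poch_succ _ _
  have h5 : poch (-((x : ℝ) + 1)) (k + 1) = poch (-((x : ℝ) + 1)) k * (-(x + 1) + k) :=
    poch_succ _ _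
  simp only [racahBasis]
  push_cast
  rw [h3, h4, h5, poch_succ]
  linear_combination (-(x + s + 1) * poch ((x : ℝ) + 1 + s + 1) k * (-x + k)) * h2

theorem racah_aux_identity (α β γ δ k y : ℝ) :
    -((y + α + 1) * (y + β + δ + 1) * (y + γ + 1)) * (y + (γ + δ) + 1 + k) +
        (y - α + (γ + δ)) * (y - β + γ) * (y + δ) * (y - k) =
      ((k + 1 + α + β + 1) * (-y + k) * (y + (γ + δ) + 1 + k) -
        (α + 1 + k) * (β + δ + 1 + k) * (γ + 1 + k)) * (2 * y + (γ + δ) + 1) := by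
  ring

theorem racah_aux_div {A p m q d e : ℝ} (hm : m ≠ 0) (hq : q ≠ 0) (h : p * d = -(q * e)) :
    A * p / (m * q) * d = -(A * e) / m := by
  rw [div_mul_eq_mul_div, div_eq_div_iff (mul_ne_zero hm hq) hm]
  linear_combination A * m * h

theorem racah_aux_div' {A p m q d e B C : ℝ} (hq : q ≠ 0) (hm : m ≠ 0) (h : p * d = q * e) :
    p * A * B * C / (q * m) * d = A * B * C * e / m := by
  rw [div_mul_eq_mul_div, div_eq_div_iff (mul_ne_zero hq hm) hm]
  linear_combination A * B * C * m * h

theorem racahOp_basis_succ (α β γ δ : ℝ) (hs : -2 < γ + δ) (k x : ℕ) :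
    racahOp α β γ δ (racahBasis (γ + δ) (k + 1)) x =
      (k + 1) * (k + 1 + α + β + 1) * racahBasis (γ + δ) (k + 1) x -
        (k + 1) * (α + 1 + k) * (β + δ + 1 + k) * (γ + 1 + k) * racahBasis (γ + δ) k x := by
  cases x with
  | zero =>
    have h0 : racahBasis (γ + δ) (k + 1) 0 = 0 := by
      have := poch_neg_eq_zero (n := 0) (k := k + 1) (by omega)
      simp only [racahBasis, this, zero_mul]
    have hd : racahDown α β γ δ 0 = 0 := by simp [racahDown]
    have hs2 : γ + δ + 2 ≠ 0 := by linarith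
    rw [racahOp, hd, h0]
    cases k with
    | zero =>
      simp [racahBasis, racahUp, poch_succ, poch_zero]
      field_simp
      ring
    | succ k =>
      have h1 : racahBasis (γ + δ) (k + 1 + 1) (0 + 1) = 0 := by
        have := poch_neg_eq_zero (n := 1) (k := k + 1 + 1) (by omega)
        simp only [racahBasis, zero_add, this, zero_mul]
      have h2 : racahBasis (γ + δ) (k + 1) 0 = 0 := by
        have := poch_neg_eq_zero (n := 0) (k := k + 1) (by omega)
        simp only [racahBasis, this, zero_mul]
      rw [h1, h2]
      simp
  | succ x =>
    have e1 := racahBasis_up (γ + δ) k (x + 1)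
    have e2 := racahBasis_down (γ + δ) k x
    have e3 : racahBasis (γ + δ) (k + 1) (x + 1) = racahBasis (γ + δ) k (x + 1) *
        ((-(x + 1) + k) * (x + 1 + (γ + δ) + 1 + k)) := by
      simp only [racahBasis, poch_succ]
      push_cast
      ring
    have hx : (0 : ℝ) ≤ x := x.cast_nonneg
    have n0 : 2 * ((x : ℝ) + 1) + (γ + δ) ≠ 0 := by linarith
    have n1 : 2 * ((x : ℝ) + 1) + (γ + δ) + 1 ≠ 0 := by linarith
    have n2 : 2 * ((x : ℝ) + 1) + (γ + δ) + 2 ≠ 0 := by linarith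
    simp only [racahOp, racahUp, racahDown, Nat.add_sub_cancel, Nat.succ_ne_zero, if_false]
    push_cast at e1 ⊢
    rw [racah_aux_div n1 n2 (e := (k + 1) * (x + 1 + (γ + δ) + 1 + k) *
        racahBasis (γ + δ) k (x + 1)) (by linear_combination e1), racah_aux_div' n0 n1
      (e := (k + 1) * (x + 1 - k) * racahBasis (γ + δ) k (x + 1)) (by linear_combination e2), e3, ← add_div, div_eq_iff n1]
    linear_combination (k + 1) * racahBasis (γ + δ) k (x + 1) *
      racah_aux_identity α β γ δ k (x + 1)

/-- The coefficients of the Racah polynomial in the basis `racahBasis`. -/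
def racahCoeff (α β γ δ : ℝ) (n k : ℕ) : ℝ :=
  poch (-(n : ℝ)) k * poch ((n : ℝ) + α + β + 1) k /
    (poch (α + 1) k * poch (β + δ + 1) k * poch (γ + 1) k * (k.factorial : ℝ))

theorem racahPoly_eq_sum (α β γ δ : ℝ) (n x : ℕ) :
    racahPoly α β γ δ n x =
      ∑ k ∈ Finset.range (n + 1), racahCoeff α β γ δ n k * racahBasis (γ + δ) k x := by
  refine Finset.sum_congr rfl fun k _ => ?_
  rw [racahCoeff, racahBasis, ← add_assoc]
  ring

theorem racahCoeff_succ {α β γ δ : ℝ} {n k : ℕ} (hα : α + 1 + k ≠ 0) (hβ : β + δ + 1 + k ≠ 0)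
    (hγ : γ + 1 + k ≠ 0) :
    racahCoeff α β γ δ n (k + 1) *
        ((k + 1) * (α + 1 + k) * (β + δ + 1 + k) * (γ + 1 + k)) =
      racahCoeff α β γ δ n k * ((-n + k) * (n + α + β + 1 + k)) := by
  have hk : (k : ℝ) + 1 ≠ 0 := by positivity
  simp only [racahCoeff, poch_succ, Nat.factorial_succ]
  push_cast
  rw [show poch (-(n : ℝ)) k * (-n + k) * (poch ((n : ℝ) + α + β + 1) k * (n + α + β + 1 + k)) /
      (poch (α + 1) k * (α + 1 + k) * (poch (β + δ + 1) k * (β + δ + 1 + k)) *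
        (poch (γ + 1) k * (γ + 1 + k)) * ((k + 1) * (k.factorial : ℝ))) =
      (poch (-(n : ℝ)) k * poch ((n : ℝ) + α + β + 1) k /
      (poch (α + 1) k * poch (β + δ + 1) k * poch (γ + 1) k * (k.factorial : ℝ))) *
      ((-n + k) * (n + α + β + 1 + k)) /
        ((k + 1) * (α + 1 + k) * (β + δ + 1 + k) * (γ + 1 + k)) by
    rw [div_mul_eq_mul_div, div_div]; congr 1 <;> ring]
  rw [div_mul_cancel₀]
  exact mul_ne_zero (mul_ne_zero (mul_ne_zero hk hα) hβ) hγ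

/-- The Racah polynomials are eigenfunctions of the Racah difference operator. -/
theorem racahOp_racahPoly {α β γ δ : ℝ} (hs : -2 < γ + δ) {n : ℕ}
    (hα : ∀ k < n, α + 1 + k ≠ 0) (hβ : ∀ k < n, β + δ + 1 + k ≠ 0)
    (hγ : ∀ k < n, γ + 1 + k ≠ 0) (x : ℕ) :
    racahOp α β γ δ (racahPoly α β γ δ n) x =
      n * (n + α + β + 1) * racahPoly α β γ δ n x := by
  have e : racahPoly α β γ δ n = fun x =>
      ∑ k ∈ Finset.range (n + 1), racahCoeff α β γ δ n k * racahBasis (γ + δ) k x :=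
    funext fun x => racahPoly_eq_sum α β γ δ n x
  have lin : racahOp α β γ δ (racahPoly α β γ δ n) x = ∑ k ∈ Finset.range (n + 1),
      racahCoeff α β γ δ n k * racahOp α β γ δ (racahBasis (γ + δ) k) x := by
    rw [e]
    simp only [racahOp, ← Finset.sum_sub_distrib, Finset.mul_sum, ← Finset.sum_add_distrib]
    exact Finset.sum_congr rfl fun k _ => by ring
  rw [lin, Finset.sum_range_succ', racahOp_basis_zero, mul_zero, add_zero, e]
  have h1 : ∀ k ∈ Finset.range n, racahCoeff α β γ δ n (k + 1) *
      racahOp α β γ δ (racahBasis (γ + δ) (k + 1)) x =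
      (((k + 1 : ℕ) : ℝ) * ((k + 1 : ℕ) + α + β + 1) * racahCoeff α β γ δ n (k + 1) *
        racahBasis (γ + δ) (k + 1) x) +
      (n * (n + α + β + 1) - k * (k + α + β + 1)) * racahCoeff α β γ δ n k *
        racahBasis (γ + δ) k x := by
    intro k hk
    have hk := Finset.mem_range.1 hk
    rw [racahOp_basis_succ α β γ δ hs]
    have := racahCoeff_succ (n := n) (hα k hk) (hβ k hk) (hγ k hk)
    push_cast
    linear_combination (-racahBasis (γ + δ) k x) * this
  rw [Finset.sum_congr rfl h1, Finset.sum_add_distrib]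
  have h2 := Finset.sum_range_succ' (fun k : ℕ => (k : ℝ) * (k + α + β + 1) *
    racahCoeff α β γ δ n k * racahBasis (γ + δ) k x) n
  have h3 := Finset.sum_range_succ (fun k : ℕ => (n * (n + α + β + 1) - k * (k + α + β + 1)) *
    racahCoeff α β γ δ n k * racahBasis (γ + δ) k x) n
  simp only [Nat.cast_zero, zero_mul, add_zero, sub_self] at h2 h3
  rw [← h2, ← h3, ← Finset.sum_add_distrib, Finset.mul_sum]
  exact Finset.sum_congr rfl fun k _ => by ring

theorem racahPoly_zero_right (α β γ δ : ℝ) (n : ℕ) : racahPoly α β γ δ n 0 = 1 := by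
  rw [racahPoly, Finset.sum_range_succ']
  have : ∀ k : ℕ, poch (-((0 : ℕ) : ℝ)) (k + 1) = 0 := fun k =>
    poch_neg_eq_zero (n := 0) (k := k + 1) (by omega)
  simp only [this]
  simp [poch_zero]

theorem racahWeight_zero (α β γ δ : ℝ) : racahWeight α β γ δ 0 = 1 := by
  simp [racahWeight, poch_zero, racahFactor]

theorem racahFactor_pos {s : ℝ} (hs : -2 < s) (x : ℕ) : 0 < racahFactor s x := by
  cases x with
  | zero => simp [racahFactor]
  | succ x =>
    have hx : (0 : ℝ) ≤ x := x.cast_nonneg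
    exact mul_pos (poch_pos (by linarith) _) (by linarith)

theorem racahFactor_succ {s : ℝ} (hs : -2 < s) (x : ℕ) :
    racahFactor s (x + 1) =
      racahFactor s x * ((if x = 0 then 1 else (x + s + 1) / (2 * x + s + 1)) *
        (2 * x + s + 3)) := by
  cases x with
  | zero => simp [racahFactor, poch_zero]; ring
  | succ x =>
    have hx : (0 : ℝ) ≤ x := x.cast_nonneg
    have n1 : 2 * ((x : ℝ) + 1) + s + 1 ≠ 0 := by linarith
    simp only [racahFactor, poch_succ, Nat.succ_ne_zero, if_false]
    push_cast
    field_simp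
    ring

/-! ### Orthogonality of the Racah polynomials -/

theorem racahUp_eq (α β γ δ : ℝ) (x : ℕ) :
    racahUp α β γ δ x = (α + 1 + x) * (β + δ + 1 + x) * (γ + 1 + x) *
      (if x = 0 then 1 else (x + (γ + δ) + 1) / (2 * x + (γ + δ) + 1)) /
        (2 * x + (γ + δ) + 2) := by
  rw [racahUp]
  split_ifs with h
  · simp [h]
  · rw [← mul_div_assoc, div_div]
    congr 1
    ring

theorem racahWeight_succ_mul {α β γ δ : ℝ} (hs : -2 < γ + δ) {x : ℕ}
    (h1 : -α + γ + δ + 1 + x ≠ 0) (h2 : -β + γ + 1 + x ≠ 0) (h3 : δ + 1 + x ≠ 0) :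
    racahWeight α β γ δ (x + 1) * racahDown α β γ δ (x + 1) =
      racahWeight α β γ δ x * racahUp α β γ δ x := by
  have hx : (0 : ℝ) ≤ x := x.cast_nonneg
  have hx1 : (x : ℝ) + 1 ≠ 0 := by linarith
  have n2 : 2 * (x : ℝ) + (γ + δ) + 2 ≠ 0 := by linarith
  have n3 : 2 * (x : ℝ) + (γ + δ) + 3 ≠ 0 := by linarith
  rw [racahUp_eq]
  set ρ : ℝ := if x = 0 then 1 else (x + (γ + δ) + 1) / (2 * x + (γ + δ) + 1) with hρ
  have eD : racahDown α β γ δ (x + 1) = (x + 1) * (-α + γ + δ + 1 + x) * (-β + γ + 1 + x) *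
      (δ + 1 + x) / ((2 * x + (γ + δ) + 2) * (2 * x + (γ + δ) + 3)) := by
    rw [racahDown]; push_cast; congr 1 <;> ring
  have eW : racahWeight α β γ δ (x + 1) = racahWeight α β γ δ x *
      ((α + 1 + x) * (β + δ + 1 + x) * (γ + 1 + x) * (ρ * (2 * x + (γ + δ) + 3)) /
        ((-α + γ + δ + 1 + x) * (-β + γ + 1 + x) * (δ + 1 + x) * (x + 1))) := by
    rw [racahWeight, racahWeight, racahFactor_succ hs, ← hρ, div_mul_div_comm]
    simp only [poch_succ, Nat.factorial_succ]
    push_cast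
    generalize α + 1 + (x : ℝ) = A, β + δ + 1 + (x : ℝ) = B, γ + 1 + (x : ℝ) = C,
      2 * (x : ℝ) + (γ + δ) + 3 = D, -α + γ + δ + 1 + (x : ℝ) = E, -β + γ + 1 + (x : ℝ) = F,
      δ + 1 + (x : ℝ) = G, (x : ℝ) + 1 = H
    congr 1 <;> ring
  rw [eD, eW, mul_assoc]
  congr 1
  generalize α + 1 + (x : ℝ) = A, β + δ + 1 + (x : ℝ) = B, γ + 1 + (x : ℝ) = C,
    2 * (x : ℝ) + (γ + δ) + 3 = D, -α + γ + δ + 1 + (x : ℝ) = E, -β + γ + 1 + (x : ℝ) = F,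
    δ + 1 + (x : ℝ) = G, (x : ℝ) + 1 = H, 2 * (x : ℝ) + (γ + δ) + 2 = J at *
  rw [div_mul_div_comm, div_eq_div_iff (by positivity) n2]
  ring

/-- The Racah difference operator is symmetric with respect to the Racah weight. -/
theorem sum_racahWeight_mul_racahOp {M : ℕ} {β γ δ : ℝ} (hs : -2 < γ + δ)
    (h1 : ∀ x < M, (M : ℝ) + 1 + γ + δ + 1 + x ≠ 0) (h2 : ∀ x < M, -β + γ + 1 + x ≠ 0)
    (h3 : ∀ x < M, δ + 1 + x ≠ 0) (f g : ℕ → ℝ) :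
    ∑ x ∈ Finset.range (M + 1), racahWeight (-(M : ℝ) - 1) β γ δ x *
        (racahOp (-(M : ℝ) - 1) β γ δ f x * g x) =
      -∑ x ∈ Finset.range M, racahWeight (-(M : ℝ) - 1) β γ δ x *
        racahUp (-(M : ℝ) - 1) β γ δ x * ((f (x + 1) - f x) * (g (x + 1) - g x)) := by
  set α : ℝ := -(M : ℝ) - 1 with hα
  have hU : racahUp α β γ δ M = 0 := by
    rw [racahUp_eq, hα]; simp
  have hD : racahDown α β γ δ 0 = 0 := by simp [racahDown]
  simp only [racahOp, add_mul, mul_add, Finset.sum_add_distrib]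
  rw [Finset.sum_range_succ, hU, Finset.sum_range_succ' (fun x => racahWeight α β γ δ x *
    (racahDown α β γ δ x * (f (x - 1) - f x) * g x)), hD]
  simp only [zero_mul, mul_zero, add_zero]
  rw [← Finset.sum_add_distrib, ← Finset.sum_neg_distrib]
  refine Finset.sum_congr rfl fun x hx => ?_
  have hx := Finset.mem_range.1 hx
  have key := racahWeight_succ_mul (α := α) hs (by rw [hα]; convert h1 x hx using 1; ring)
    (h2 x hx) (h3 x hx)
  simp only [Nat.add_sub_cancel]
  linear_combination ((f x - f (x + 1)) * g (x + 1)) * key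

section Ensemble

variable {a b c : ℝ} {M : ℕ}

theorem racahWeight_pos (ha : -1 < a) (hb : -1 < b) (hc : 0 < c) {x : ℕ} (hx : x ≤ M) :
    0 < racahWeight (-(M : ℝ) - 1) (M + a + c) a b x := by
  rcases Nat.eq_zero_or_pos x with rfl | hx0
  · rw [racahWeight_zero]; exact one_pos
  have hM : (1 : ℝ) ≤ M := by exact_mod_cast hx0.trans_le hx
  have e : racahWeight (-(M : ℝ) - 1) (M + a + c) a b x =
      (poch (-(M : ℝ) - 1 + 1) x / poch (-(M + a + c) + a + 1) x) *
      (poch (M + a + c + b + 1) x * poch (a + 1) x * racahFactor (a + b) x /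
        (poch (-(-(M : ℝ) - 1) + a + b + 1) x * poch (b + 1) x * (x.factorial : ℝ))) := by
    rw [racahWeight, div_mul_div_comm]; congr 1 <;> ring
  rw [e]
  refine mul_pos (poch_neg_div_pos fun j hj => ?_) (div_pos ?_ ?_)
  · have : (j : ℝ) + 1 ≤ M := by exact_mod_cast (by omega : j + 1 ≤ M)
    constructor <;> linarith
  · exact mul_pos (mul_pos (poch_pos (by linarith) _) (poch_pos (by linarith) _))
      (racahFactor_pos (by linarith) _)
  · exact mul_pos (mul_pos (poch_pos (by linarith) _) (poch_pos (by linarith) _)) (by positivity)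

theorem sum_racahPoly_mul_racahPoly (ha : -1 < a) (hb : -1 < b) (hc : 0 < c) {m n : ℕ}
    (hm : m ≤ M) (hn : n ≤ M) (hmn : m ≠ n) :
    ∑ x ∈ Finset.range (M + 1), racahWeight (-(M : ℝ) - 1) (M + a + c) a b x *
      (racahPoly (-(M : ℝ) - 1) (M + a + c) a b m x *
        racahPoly (-(M : ℝ) - 1) (M + a + c) a b n x) = 0 := by
  have hs : -2 < a + b := by linarith
  have op : ∀ n ≤ M, ∀ x, racahOp (-(M : ℝ) - 1) (M + a + c) a b
      (racahPoly (-(M : ℝ) - 1) (M + a + c) a b n) x =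
      n * (n + a + c) * racahPoly (-(M : ℝ) - 1) (M + a + c) a b n x := by
    intro n hn x
    rw [racahOp_racahPoly hs]
    · ring
    · intro k hk
      have : (k : ℝ) + 1 ≤ M := by exact_mod_cast (by omega : k + 1 ≤ M)
      exact (by linarith : -(M : ℝ) - 1 + 1 + k < 0).ne
    · intro k hk
      have : (k : ℝ) + 1 ≤ M := by exact_mod_cast (by omega : k + 1 ≤ M)
      have hk0 : (0 : ℝ) ≤ k := k.cast_nonneg
      exact (by linarith : 0 < (M : ℝ) + a + c + b + 1 + k).ne'
    · intro k hk
      have hk0 : (0 : ℝ) ≤ k := k.cast_nonneg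
      exact (by linarith : 0 < a + 1 + k).ne'
  have sym := sum_racahWeight_mul_racahOp (M := M) (β := M + a + c) hs
    (fun x hx => by
      have : (x : ℝ) + 1 ≤ M := by exact_mod_cast hx
      have hx0 : (0 : ℝ) ≤ x := x.cast_nonneg
      exact (by linarith : 0 < (M : ℝ) + 1 + a + b + 1 + x).ne')
    (fun x hx => by
      have : (x : ℝ) + 1 ≤ M := by exact_mod_cast hx
      exact (by linarith : -((M : ℝ) + a + c) + a + 1 + x < 0).ne)
    (fun x hx => by
      have hx0 : (0 : ℝ) ≤ x := x.cast_nonneg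
      exact (by linarith : 0 < b + 1 + x).ne')
  have e1 := sym (racahPoly (-(M : ℝ) - 1) (M + a + c) a b m)
    (racahPoly (-(M : ℝ) - 1) (M + a + c) a b n)
  have e2 := sym (racahPoly (-(M : ℝ) - 1) (M + a + c) a b n)
    (racahPoly (-(M : ℝ) - 1) (M + a + c) a b m)
  simp only [op m hm, op n hn] at e1 e2
  set S := ∑ x ∈ Finset.range (M + 1), racahWeight (-(M : ℝ) - 1) (M + a + c) a b x *
      (racahPoly (-(M : ℝ) - 1) (M + a + c) a b m x *
        racahPoly (-(M : ℝ) - 1) (M + a + c) a b n x) with hS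
  have f1 : (m * (m + a + c) : ℝ) * S = n * (n + a + c) * S := by
    trans ∑ x ∈ Finset.range (M + 1), racahWeight (-(M : ℝ) - 1) (M + a + c) a b x *
      (m * (m + a + c) * racahPoly (-(M : ℝ) - 1) (M + a + c) a b m x *
        racahPoly (-(M : ℝ) - 1) (M + a + c) a b n x)
    · rw [hS, Finset.mul_sum]; exact Finset.sum_congr rfl fun x _ => by ring
    · rw [e1, hS, Finset.mul_sum]
      refine Eq.trans ?_ (e2.symm.trans ?_)
      · simp only [mul_comm (racahPoly (-(M : ℝ) - 1) (M + a + c) a b m (_ + 1) - _)]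
      · exact Finset.sum_congr rfl fun x _ => by ring
  have hne : (m * (m + a + c) : ℝ) ≠ n * (n + a + c) := by
    intro h
    have h' : ((m : ℝ) - n) * (m + n + a + c) = 0 := by linear_combination h
    rcases mul_eq_zero.1 h' with h' | h'
    · exact hmn (by exact_mod_cast sub_eq_zero.1 h')
    · have : (1 : ℝ) ≤ m + n := by exact_mod_cast (by omega : 1 ≤ m + n)
      linarith
  by_contra hS0
  exact hne (mul_right_cancel₀ hS0 f1)

theorem one_le_racahNormSq (ha : -1 < a) (hb : -1 < b) (hc : 0 < c) (n : ℕ) :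
    1 ≤ racahNormSq M (-(M : ℝ) - 1) (M + a + c) a b n := by
  have := Finset.single_le_sum (f := fun x => racahWeight (-(M : ℝ) - 1) (M + a + c) a b x *
    racahPoly (-(M : ℝ) - 1) (M + a + c) a b n x ^ 2) (s := Finset.range (M + 1))
    (fun x hx => mul_nonneg (racahWeight_pos ha hb hc
      (Nat.lt_succ_iff.1 (Finset.mem_range.1 hx))).le (sq_nonneg _))
    (Finset.mem_range.2 M.succ_pos)
  rw [racahNormSq]
  simpa [racahWeight_zero, racahPoly_zero_right] using this

/-- The matrix of the orthonormal Racah functions. -/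
def racahMatrix (M : ℕ) (a b c : ℝ) : Matrix (Fin (M + 1)) (Fin (M + 1)) ℝ :=
  Matrix.of fun n x => Real.sqrt (racahWeight (-(M : ℝ) - 1) (M + a + c) a b x) *
    racahPoly (-(M : ℝ) - 1) (M + a + c) a b n x /
      Real.sqrt (racahNormSq M (-(M : ℝ) - 1) (M + a + c) a b n)

theorem racahMatrix_mul_transpose (ha : -1 < a) (hb : -1 < b) (hc : 0 < c) :
    racahMatrix M a b c * (racahMatrix M a b c).transpose = 1 := by
  ext m n
  have hpos : ∀ n : ℕ, 0 < racahNormSq M (-(M : ℝ) - 1) (M + a + c) a b n := fun n =>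
    zero_lt_one.trans_le (one_le_racahNormSq ha hb hc n)
  have e : (racahMatrix M a b c * (racahMatrix M a b c).transpose) m n =
      (∑ x ∈ Finset.range (M + 1), racahWeight (-(M : ℝ) - 1) (M + a + c) a b x *
      (racahPoly (-(M : ℝ) - 1) (M + a + c) a b m x *
        racahPoly (-(M : ℝ) - 1) (M + a + c) a b n x)) /
      (Real.sqrt (racahNormSq M (-(M : ℝ) - 1) (M + a + c) a b m) *
        Real.sqrt (racahNormSq M (-(M : ℝ) - 1) (M + a + c) a b n)) := by
    rw [Matrix.mul_apply, Finset.sum_range, Finset.sum_div]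
    refine Finset.sum_congr rfl fun x _ => ?_
    have hw := Real.mul_self_sqrt (racahWeight_pos ha hb hc (Nat.lt_succ_iff.1 x.2)).le
    simp only [racahMatrix, Matrix.of_apply, Matrix.transpose_apply, div_mul_div_comm]
    congr 1
    linear_combination (racahPoly (-(M : ℝ) - 1) (M + a + c) a b m x *
        racahPoly (-(M : ℝ) - 1) (M + a + c) a b n x) * hw
  rw [e]
  rcases eq_or_ne m n with rfl | h
  · rw [Real.mul_self_sqrt (hpos _).le, Matrix.one_apply_eq]
    refine Eq.trans ?_ (div_self (hpos m).ne')
    congr 1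
    exact Finset.sum_congr rfl fun x _ => by ring
  · rw [sum_racahPoly_mul_racahPoly ha hb hc (Nat.lt_succ_iff.1 m.2) (Nat.lt_succ_iff.1 n.2)
      (fun h' => h (Fin.ext h')), zero_div, Matrix.one_apply_ne h]

theorem transpose_mul_racahMatrix (ha : -1 < a) (hb : -1 < b) (hc : 0 < c) :
    (racahMatrix M a b c).transpose * racahMatrix M a b c = 1 :=
  mul_eq_one_comm.1 (racahMatrix_mul_transpose ha hb hc)

theorem racahMatrix_mul_self (ha : -1 < a) (hb : -1 < b) (hc : 0 < c) (n x y : Fin (M + 1)) :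
    racahMatrix M a b c n x * racahMatrix M a b c n y =
      Real.sqrt (racahWeight (-(M : ℝ) - 1) (M + a + c) a b x *
        racahWeight (-(M : ℝ) - 1) (M + a + c) a b y) *
      (racahPoly (-(M : ℝ) - 1) (M + a + c) a b n x *
        racahPoly (-(M : ℝ) - 1) (M + a + c) a b n y /
          racahNormSq M (-(M : ℝ) - 1) (M + a + c) a b n) := by
  have h1 := Real.mul_self_sqrt
    (zero_le_one.trans (one_le_racahNormSq (M := M) ha hb hc n))
  rw [Real.sqrt_mul (racahWeight_pos ha hb hc (Nat.lt_succ_iff.1 x.2)).le]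
  simp only [racahMatrix, Matrix.of_apply, div_mul_div_comm, h1]
  ring

/-- Dual orthogonality of the Racah polynomials. -/
theorem sum_racahPoly_mul_racahPoly_div_normSq (ha : -1 < a) (hb : -1 < b) (hc : 0 < c) {x y : ℕ}
    (hx : x ≤ M) (hy : y ≤ M) :
    ∑ n ∈ Finset.range (M + 1), racahPoly (-(M : ℝ) - 1) (M + a + c) a b n x *
        racahPoly (-(M : ℝ) - 1) (M + a + c) a b n y /
          racahNormSq M (-(M : ℝ) - 1) (M + a + c) a b n =
      if x = y then (racahWeight (-(M : ℝ) - 1) (M + a + c) a b x)⁻¹ else 0 := by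
  have h := congrFun (congrFun (transpose_mul_racahMatrix (M := M) ha hb hc)
    ⟨x, Nat.lt_succ_iff.2 hx⟩) ⟨y, Nat.lt_succ_iff.2 hy⟩
  simp only [Matrix.mul_apply, Matrix.transpose_apply, racahMatrix_mul_self ha hb hc,
    ← Finset.mul_sum] at h
  rw [← Finset.sum_range (fun n => racahPoly (-(M : ℝ) - 1) (M + a + c) a b n x *
        racahPoly (-(M : ℝ) - 1) (M + a + c) a b n y /
          racahNormSq M (-(M : ℝ) - 1) (M + a + c) a b n)] at h
  have hW := mul_pos (racahWeight_pos ha hb hc hx) (racahWeight_pos ha hb hc hy)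
  split_ifs with hxy
  · subst hxy
    rw [Real.sqrt_mul_self (racahWeight_pos ha hb hc hx).le, Matrix.one_apply_eq] at h
    exact eq_inv_of_mul_eq_one_right h
  · rw [Matrix.one_apply_ne (fun h => hxy (congrArg Fin.val h))] at h
    exact (mul_eq_zero.1 h).resolve_left (Real.sqrt_pos.2 hW).ne'

theorem exists_isRacahEnsemble (ha : -1 < a) (hb : -1 < b) (hc : 0 < c) {N : ℕ} (hN : N ≤ M) :
    ∃ P, IsRacahEnsemble N M (M + a + c) a b P := by
  set Φ := racahMatrix M a b c
  let D : Matrix (Fin (M + 1)) (Fin (M + 1)) ℝ :=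
    Matrix.diagonal fun n => if (n : ℕ) < N then 1 else 0
  have hD : D * D = D := by simp [D, Matrix.diagonal_mul_diagonal]
  have hΦ : Φ * Φ.transpose = 1 := racahMatrix_mul_transpose ha hb hc
  refine exists_isDeterminantal_of_projection (K := Φ.transpose * D * Φ) ?_ ?_
    Fin.valEmbedding _ (fun x y => ?_) fun x y hx => ?_
  · rw [Matrix.transpose_mul, Matrix.transpose_mul, Matrix.transpose_transpose,
      Matrix.diagonal_transpose, Matrix.mul_assoc]
  · calc Φ.transpose * D * Φ * (Φ.transpose * D * Φ)
        = Φ.transpose * D * (Φ * Φ.transpose) * D * Φ := by simp only [Matrix.mul_assoc]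
      _ = Φ.transpose * D * Φ := by rw [hΦ, Matrix.mul_one, Matrix.mul_assoc _ D D, hD]
  · have hx := Nat.lt_succ_iff.1 x.2
    have hy := Nat.lt_succ_iff.1 y.2
    simp only [Fin.valEmbedding_apply, racahKernel, hx, hy, and_self, if_true]
    rw [Finset.mul_sum, Matrix.mul_apply]
    simp only [D, Matrix.mul_diagonal, Matrix.transpose_apply]
    let F : ℕ → ℝ := fun n => Real.sqrt (racahWeight (-(M : ℝ) - 1) (M + a + c) a b x *
        racahWeight (-(M : ℝ) - 1) (M + a + c) a b y) *
      (racahPoly (-(M : ℝ) - 1) (M + a + c) a b n x *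
        racahPoly (-(M : ℝ) - 1) (M + a + c) a b n y /
          racahNormSq M (-(M : ℝ) - 1) (M + a + c) a b n)
    have : ∀ n : Fin (M + 1), Φ n x * (if (n : ℕ) < N then 1 else 0) * Φ n y =
        (fun n : ℕ => if n < N then F n else 0) n := fun n => by
      rw [mul_right_comm, racahMatrix_mul_self ha hb hc]
      simp [F]
    rw [Finset.sum_congr rfl fun n _ => this n,
      ← Finset.sum_range (fun n : ℕ => if n < N then F n else 0), ← Finset.sum_filter]
    refine Finset.sum_congr ?_ fun _ _ => rfl
    ext n
    simp only [Finset.mem_range, Finset.mem_filter]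
    omega
  · have : ¬ x ≤ M := fun h => hx ⟨⟨x, Nat.lt_succ_iff.2 h⟩, rfl⟩
    simp [racahKernel, this]

end Ensemble

/-! ### Convergence of discrete measures from convergence of moments -/

theorem integrable_of_continuous_of_ae_mem_Icc {ν : Measure ℝ} [IsFiniteMeasure ν]
    (hν : ∀ᵐ x ∂ν, x ∈ Set.Icc (0 : ℝ) 1) {g : ℝ → ℝ} (hg : Continuous g) : Integrable g ν := by
  obtain ⟨C, hC⟩ := isCompact_Icc.exists_bound_of_continuousOn (s := Set.Icc (0 : ℝ) 1)
    hg.continuousOn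
  exact Integrable.of_bound hg.aestronglyMeasurable C (hν.mono hC)

theorem tendsto_sum_polynomial {w u : ℕ → ℕ → ℝ} {s : ℕ → Finset ℕ} {ν : Measure ℝ}
    [IsFiniteMeasure ν] (hν : ∀ᵐ x ∂ν, x ∈ Set.Icc (0 : ℝ) 1)
    (hmom : ∀ j : ℕ, Tendsto (fun k => ∑ n ∈ s k, w k n * u k n ^ j) atTop (𝓝 (∫ x, x ^ j ∂ν)))
    (p : Polynomial ℝ) :
    Tendsto (fun k => ∑ n ∈ s k, w k n * p.eval (u k n)) atTop (𝓝 (∫ x, p.eval x ∂ν)) := by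
  simp only [Polynomial.eval_eq_sum_range]
  rw [integral_finsetSum _ fun j _ => (integrable_of_continuous_of_ae_mem_Icc hν (by fun_prop))]
  simp only [integral_const_mul, Finset.mul_sum]
  have e : ∀ k, ∑ n ∈ s k, ∑ i ∈ Finset.range (p.natDegree + 1),
      w k n * (p.coeff i * u k n ^ i) =
      ∑ i ∈ Finset.range (p.natDegree + 1), p.coeff i * ∑ n ∈ s k, w k n * u k n ^ i := by
    intro k
    rw [Finset.sum_comm]
    refine Finset.sum_congr rfl fun i _ => ?_
    rw [Finset.mul_sum]
    exact Finset.sum_congr rfl fun n _ => by ring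
  simp only [e]
  exact tendsto_finsetSum _ fun i _ => (hmom i).const_mul _

theorem abs_sum_mul_sub_le {s : Finset ℕ} {w f g h : ℕ → ℝ} (hw : ∀ n ∈ s, 0 ≤ w n)
    (hfg : ∀ n ∈ s, |f n - g n| ≤ h n) :
    |∑ n ∈ s, w n * f n - ∑ n ∈ s, w n * g n| ≤ ∑ n ∈ s, w n * h n := by
  rw [← Finset.sum_sub_distrib]
  refine (Finset.abs_sum_le_sum_abs _ _).trans (Finset.sum_le_sum fun n hn => ?_)
  rw [← mul_sub, abs_mul, abs_of_nonneg (hw n hn)]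
  exact mul_le_mul_of_nonneg_left (hfg n hn) (hw n hn)

theorem tendsto_sum_continuous {w u : ℕ → ℕ → ℝ} {s : ℕ → Finset ℕ} {ν : Measure ℝ}
    [IsProbabilityMeasure ν] (hν : ∀ᵐ x ∂ν, x ∈ Set.Icc (0 : ℝ) 1)
    (hw : ∀ k, ∀ n ∈ s k, 0 ≤ w k n) (hw1 : ∀ k, ∑ n ∈ s k, w k n = 1)
    (hu : ∀ k, ∀ n ∈ s k, u k n ∈ Set.Icc (0 : ℝ) 1)
    (hmom : ∀ j : ℕ, Tendsto (fun k => ∑ n ∈ s k, w k n * u k n ^ j) atTop (𝓝 (∫ x, x ^ j ∂ν)))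
    {g : ℝ → ℝ} (hg : Continuous g) :
    Tendsto (fun k => ∑ n ∈ s k, w k n * g (u k n)) atTop (𝓝 (∫ x, g x ∂ν)) := by
  rw [Metric.tendsto_atTop]
  intro ε hε
  obtain ⟨p, hp⟩ := exists_polynomial_near_of_continuousOn 0 1 g hg.continuousOn (ε / 3)
    (by positivity)
  obtain ⟨k₀, hk₀⟩ := Metric.tendsto_atTop.1 (tendsto_sum_polynomial hν hmom p) (ε / 3)
    (by positivity)
  refine ⟨k₀, fun k hk => ?_⟩
  have h1 := hk₀ k hk
  have h2 : |∑ n ∈ s k, w k n * p.eval (u k n) - ∑ n ∈ s k, w k n * g (u k n)| ≤ ε / 3 := by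
    refine (abs_sum_mul_sub_le (h := fun _ => ε / 3) (hw k)
      fun n hn => (hp _ (hu k n hn)).le).trans ?_
    rw [← Finset.sum_mul, hw1, one_mul]
  have h3 : |∫ x, p.eval x ∂ν - ∫ x, g x ∂ν| ≤ ε / 3 := by
    rw [← integral_sub (integrable_of_continuous_of_ae_mem_Icc hν p.continuous)
      (integrable_of_continuous_of_ae_mem_Icc hν hg)]
    have := norm_integral_le_of_norm_le_const (μ := ν) (C := ε / 3)
      (f := fun x => p.eval x - g x) (hν.mono fun x hx => (hp x hx).le)
    simpa using this
  rw [Real.dist_eq] at h1 ⊢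
  rw [abs_lt] at h1 ⊢
  rw [abs_le] at h2 h3
  constructor <;> linarith

/-- A continuous approximation to the indicator function of `(-∞, ρ)`. -/
def stepApprox (ρ ε x : ℝ) : ℝ := max 0 (min 1 ((ρ - x) / (2 * ε) + 1 / 2))

/-- A continuous bump function around `ρ`. -/
def bumpApprox (ρ ε x : ℝ) : ℝ := max 0 (min 1 (2 - |x - ρ| / ε))

theorem continuous_stepApprox (ρ ε : ℝ) : Continuous (stepApprox ρ ε) := by
  unfold stepApprox; fun_prop

theorem continuous_bumpApprox (ρ ε : ℝ) : Continuous (bumpApprox ρ ε) := by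
  unfold bumpApprox; fun_prop

theorem bumpApprox_mem (ρ ε x : ℝ) : bumpApprox ρ ε x ∈ Set.Icc (0 : ℝ) 1 :=
  ⟨le_max_left _ _, max_le zero_le_one (min_le_left _ _)⟩

theorem stepApprox_mem (ρ ε x : ℝ) : stepApprox ρ ε x ∈ Set.Icc (0 : ℝ) 1 :=
  ⟨le_max_left _ _, max_le zero_le_one (min_le_left _ _)⟩

theorem abs_sub_stepApprox_le {ρ ε : ℝ} (hε : 0 < ε) {t x i : ℝ} (ht : |t - ρ| ≤ ε)
    (hi : i = 1 ∧ x ≤ t ∨ i = 0 ∧ t ≤ x) : |i - stepApprox ρ ε x| ≤ bumpApprox ρ ε x := by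
  have hs := stepApprox_mem ρ ε x
  have hb := bumpApprox_mem ρ ε x
  rw [abs_le] at ht
  by_cases h : |x - ρ| ≤ ε
  · have e : bumpApprox ρ ε x = 1 := by
      have : |x - ρ| / ε ≤ 1 := (div_le_one hε).2 h
      rw [bumpApprox, min_eq_left (by linarith), max_eq_right zero_le_one]
    rw [e, abs_le]
    rcases hi with ⟨rfl, -⟩ | ⟨rfl, -⟩ <;> constructor <;> linarith [hs.1, hs.2]
  · rw [abs_le, not_and_or, not_le, not_le] at h
    rcases h with h | h
    · have e : stepApprox ρ ε x = 1 := by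
        have : 1 / 2 ≤ (ρ - x) / (2 * ε) := by
          rw [div_le_div_iff₀ two_pos (by positivity)]; linarith
        rw [stepApprox, min_eq_left (by linarith), max_eq_right zero_le_one]
      rcases hi with ⟨rfl, -⟩ | ⟨rfl, hx⟩
      · rw [e]; simpa using hb.1
      · linarith
    · have e : stepApprox ρ ε x = 0 := by
        have : (ρ - x) / (2 * ε) ≤ -(1 / 2) := by
          rw [div_le_iff₀ (by positivity)]; linarith
        rw [stepApprox, max_eq_left ((min_le_right _ _).trans (by linarith))]
      rcases hi with ⟨rfl, hx⟩ | ⟨rfl, -⟩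
      · linarith
      · rw [e]; simpa using hb.1

theorem tendsto_integral_bumpApprox {ν : Measure ℝ} [IsProbabilityMeasure ν] {ρ : ℝ}
    (hρ : ν {ρ} = 0) :
    Tendsto (fun m : ℕ => ∫ x, bumpApprox ρ (1 / ((m : ℝ) + 1)) x ∂ν) atTop (𝓝 0) := by
  have : Tendsto (fun m : ℕ => ∫ x, bumpApprox ρ (1 / ((m : ℝ) + 1)) x ∂ν) atTop
      (𝓝 (∫ _, (0 : ℝ) ∂ν)) := by
    refine tendsto_integral_of_dominated_convergence (fun _ => 1)
      (fun m => (continuous_bumpApprox _ _).aestronglyMeasurable) (integrable_const _)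
      (fun m => ae_of_all _ fun x => ?_) ?_
    · have := bumpApprox_mem ρ (1 / ((m : ℝ) + 1)) x
      rw [Real.norm_eq_abs, abs_of_nonneg this.1]
      exact this.2
    · have hne : ∀ᵐ x ∂ν, x ≠ ρ := by
        rw [ae_iff]; simpa using hρ
      filter_upwards [hne] with x hx
      have hpos : 0 < |x - ρ| := abs_pos.2 (sub_ne_zero.2 hx)
      obtain ⟨m₀, hm₀⟩ := exists_nat_gt (2 / |x - ρ|)
      refine tendsto_const_nhds.congr' ?_
      filter_upwards [eventually_ge_atTop m₀] with m hm
      have hm' : (m₀ : ℝ) ≤ m := by exact_mod_cast hm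
      have : 2 ≤ |x - ρ| / (1 / ((m : ℝ) + 1)) := by
        rw [div_div_eq_mul_div, div_one]
        rw [div_lt_iff₀ hpos] at hm₀
        nlinarith
      rw [bumpApprox, max_eq_left ((min_le_right _ _).trans (by linarith))]
  simpa using this

theorem tendsto_sum_truncated {w u : ℕ → ℕ → ℝ} {s : ℕ → Finset ℕ} {ν : Measure ℝ}
    [IsProbabilityMeasure ν] (hν : ∀ᵐ x ∂ν, x ∈ Set.Icc (0 : ℝ) 1)
    (hw : ∀ k, ∀ n ∈ s k, 0 ≤ w k n) (hw1 : ∀ k, ∑ n ∈ s k, w k n = 1)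
    (hu : ∀ k, ∀ n ∈ s k, u k n ∈ Set.Icc (0 : ℝ) 1)
    (hmom : ∀ j : ℕ, Tendsto (fun k => ∑ n ∈ s k, w k n * u k n ^ j) atTop (𝓝 (∫ x, x ^ j ∂ν)))
    {N : ℕ → ℕ} {t : ℕ → ℝ} {ρ : ℝ} (hρ : ν {ρ} = 0) (ht : Tendsto t atTop (𝓝 ρ))
    (hlt : ∀ᶠ k in atTop, ∀ n ∈ s k, n < N k → u k n ≤ t k)
    (hge : ∀ᶠ k in atTop, ∀ n ∈ s k, N k ≤ n → t k ≤ u k n)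
    {g : ℝ → ℝ} (hg : Continuous g) :
    Tendsto (fun k => ∑ n ∈ s k, w k n * (if n < N k then g (u k n) else 0)) atTop
      (𝓝 (∫ x in Set.Iio ρ, g x ∂ν)) := by
  obtain ⟨C, hC⟩ := isCompact_Icc.exists_bound_of_continuousOn (s := Set.Icc (0 : ℝ) 1)
    hg.continuousOn
  have hC0 : 0 ≤ C := (norm_nonneg _).trans (hC 0 (by simp))
  rw [← integral_indicator measurableSet_Iio, Metric.tendsto_atTop']
  intro η hη
  have hη' : 0 < η / (4 * (C + 1)) := by positivity
  obtain ⟨m, hm⟩ := (((tendsto_integral_bumpApprox hρ).eventually (gt_mem_nhds hη'))).exists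
  set ε : ℝ := 1 / ((m : ℝ) + 1) with hεdef
  have hε : 0 < ε := by positivity
  have hψ := tendsto_sum_continuous hν hw hw1 hu hmom (continuous_bumpApprox ρ ε)
  have hχ := tendsto_sum_continuous hν hw hw1 hu hmom ((continuous_stepApprox ρ ε).mul hg)
  have hb0 : 0 ≤ ∫ x, bumpApprox ρ ε x ∂ν := integral_nonneg fun x => (bumpApprox_mem ρ ε x).1
  have hCη : C * (η / (4 * (C + 1))) ≤ η / 4 := by
    rw [mul_div_assoc', div_le_div_iff₀ (by positivity) (by norm_num)]
    nlinarith
  have hfin : ∀ᶠ k in atTop, dist (∑ n ∈ s k, w k n * (if n < N k then g (u k n) else 0))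
      (∫ x, (Set.Iio ρ).indicator g x ∂ν) < η := by
    filter_upwards [hlt, hge, hψ.eventually (gt_mem_nhds hm),
      Metric.tendsto_nhds.1 hχ (η / 4) (by positivity),
      Metric.tendsto_nhds.1 ht ε hε] with k h1 h2 h3 h4 h5
    have a1 : |∑ n ∈ s k, w k n * (if n < N k then g (u k n) else 0) -
        ∑ n ∈ s k, w k n * (stepApprox ρ ε * g) (u k n)| ≤
        ∑ n ∈ s k, w k n * (bumpApprox ρ ε (u k n) * C) := by
      refine abs_sum_mul_sub_le (hw k) fun n hn => ?_
      have hgC := hC _ (hu k n hn)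
      have key := abs_sub_stepApprox_le (x := u k n) hε (i := if n < N k then 1 else 0) h5.le (by
        by_cases h : n < N k
        · exact Or.inl ⟨if_pos h, h1 n hn h⟩
        · exact Or.inr ⟨if_neg h, h2 n hn (not_lt.1 h)⟩)
      have e : (if n < N k then g (u k n) else 0) - (stepApprox ρ ε * g) (u k n) =
          ((if n < N k then 1 else 0) - stepApprox ρ ε (u k n)) * g (u k n) := by
        simp only [Pi.mul_apply]; split_ifs <;> ring
      rw [e, abs_mul]
      exact mul_le_mul key hgC (abs_nonneg _) (bumpApprox_mem _ _ _).1
    have a2 : ∑ n ∈ s k, w k n * (bumpApprox ρ ε (u k n) * C) ≤ η / 4 := by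
      simp only [← mul_assoc]
      rw [← Finset.sum_mul, mul_comm]
      exact (mul_le_mul_of_nonneg_left h3.le hC0).trans hCη
    have a3 : |∫ x, (stepApprox ρ ε * g) x ∂ν - ∫ x, (Set.Iio ρ).indicator g x ∂ν| ≤ η / 4 := by
      rw [← integral_sub
        (integrable_of_continuous_of_ae_mem_Icc hν ((continuous_stepApprox ρ ε).mul hg))
        ((integrable_of_continuous_of_ae_mem_Icc hν hg).indicator measurableSet_Iio)]
      rw [← Real.norm_eq_abs]
      refine (norm_integral_le_of_norm_le (g := fun x => C * bumpApprox ρ ε x)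
        ((integrable_of_continuous_of_ae_mem_Icc hν
          (continuous_bumpApprox ρ ε)).const_mul C) ?_).trans ?_
      · filter_upwards [hν] with x hx
        have key := abs_sub_stepApprox_le (x := x) (t := ρ) (ρ := ρ) hε
          (i := if x < ρ then 1 else 0) (by simpa using hε.le) (by
          by_cases h : x < ρ
          · exact Or.inl ⟨if_pos h, h.le⟩
          · exact Or.inr ⟨if_neg h, not_lt.1 h⟩)
        have e : (stepApprox ρ ε * g) x - (Set.Iio ρ).indicator g x =
            -(((if x < ρ then 1 else 0) - stepApprox ρ ε x) * g x) := by
          simp only [Pi.mul_apply, Set.indicator_apply, Set.mem_Iio]; split_ifs <;> ring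
        rw [e, norm_neg, norm_mul, mul_comm]
        exact mul_le_mul (hC x hx) key (abs_nonneg _) hC0
      · rw [integral_const_mul]
        exact (mul_le_mul_of_nonneg_left hm.le hC0).trans hCη
    rw [Real.dist_eq, abs_lt] at h4 ⊢
    rw [abs_le] at a1 a3
    simp only [Pi.mul_apply] at a1 a3 h4 ⊢
    constructor <;> linarith
  obtain ⟨k₀, hk₀⟩ := eventually_atTop.1 hfin
  exact ⟨k₀, fun k hk => hk₀ k hk.le⟩

/-! ### The beta distribution -/

theorem ae_betaMeasure_mem_Icc (p q : ℝ) :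
    ∀ᵐ x ∂ProbabilityTheory.betaMeasure p q, x ∈ Set.Icc (0 : ℝ) 1 := by
  rw [ae_iff, ProbabilityTheory.betaMeasure, withDensity_apply' _ _]
  refine (setLIntegral_congr_fun (g := fun _ => 0) ?_ fun x hx => ?_).trans (by simp)
  · exact measurableSet_Icc.compl
  · have hx : ¬ x ∈ Set.Icc (0 : ℝ) 1 := hx
    rw [Set.mem_Icc, not_and_or, not_le, not_le] at hx
    rcases hx with h | h
    · exact ProbabilityTheory.betaPDF_eq_zero_of_nonpos h.le
    · exact ProbabilityTheory.betaPDF_eq_zero_of_one_le h.le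

theorem betaMeasure_singleton (p q x : ℝ) : ProbabilityTheory.betaMeasure p q {x} = 0 :=
  withDensity_absolutelyContinuous _ _ (by simp)

theorem measurable_betaPDF (p q : ℝ) : Measurable (ProbabilityTheory.betaPDF p q) :=
  (ProbabilityTheory.measurable_betaPDFReal p q).ennreal_ofReal

theorem betaPDFReal_nonneg {p q : ℝ} (hp : 0 < p) (hq : 0 < q) (x : ℝ) :
    0 ≤ ProbabilityTheory.betaPDFReal p q x := by
  by_cases h : 0 < x ∧ x < 1
  · exact (ProbabilityTheory.betaPDFReal_pos h.1 h.2 hp hq).le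
  · rw [ProbabilityTheory.betaPDFReal, if_neg h]

theorem toReal_betaPDF {p q : ℝ} (hp : 0 < p) (hq : 0 < q) (x : ℝ) :
    (ProbabilityTheory.betaPDF p q x).toReal = ProbabilityTheory.betaPDFReal p q x :=
  ENNReal.toReal_ofReal (betaPDFReal_nonneg hp hq x)

theorem integral_betaMeasure {p q : ℝ} (hp : 0 < p) (hq : 0 < q) (g : ℝ → ℝ) :
    ∫ x, g x ∂ProbabilityTheory.betaMeasure p q =
      ∫ x, ProbabilityTheory.betaPDFReal p q x * g x := by
  rw [ProbabilityTheory.betaMeasure, integral_withDensity_eq_integral_toReal_smul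
    (measurable_betaPDF p q) (ae_of_all _ fun _ => ENNReal.ofReal_lt_top)]
  simp only [toReal_betaPDF hp hq, smul_eq_mul]

theorem integral_betaPDFReal {p q : ℝ} (hp : 0 < p) (hq : 0 < q) :
    ∫ x, ProbabilityTheory.betaPDFReal p q x = 1 := by
  have := ProbabilityTheory.isProbabilityMeasureBeta hp hq
  simpa using (integral_betaMeasure hp hq fun _ => 1).symm

theorem beta_add_nat_div {p q : ℝ} (hp : 0 < p) (hq : 0 < q) (j : ℕ) :
    ProbabilityTheory.beta (p + j) q / ProbabilityTheory.beta p q =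
      poch p j / poch (p + q) j := by
  have hg : ∀ {x : ℝ}, 0 < x → ∀ j : ℕ, Real.Gamma (x + j) = poch x j * Real.Gamma x := by
    intro x hx j
    induction j with
    | zero => simp [poch_zero]
    | succ j ih =>
      have : x + j ≠ 0 := by positivity
      push_cast
      rw [← add_assoc, Real.Gamma_add_one this, ih, poch_succ]
      ring
  have e : p + j + q = p + q + j := by ring
  rw [ProbabilityTheory.beta, ProbabilityTheory.beta, e, hg hp, hg (add_pos hp hq)]
  have h1 := (Real.Gamma_pos_of_pos hp).ne'
  have h2 := (Real.Gamma_pos_of_pos hq).ne'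
  have h3 := (Real.Gamma_pos_of_pos (add_pos hp hq)).ne'
  have h4 := (poch_pos (add_pos hp hq) j).ne'
  field_simp

theorem integral_pow_betaMeasure {p q : ℝ} (hp : 0 < p) (hq : 0 < q) (j : ℕ) :
    ∫ x, x ^ j ∂ProbabilityTheory.betaMeasure p q = poch p j / poch (p + q) j := by
  have hpj : 0 < p + j := by positivity
  rw [integral_betaMeasure hp hq, ← beta_add_nat_div hp hq]
  have e : ∀ x, ProbabilityTheory.betaPDFReal p q x * x ^ j =
      ProbabilityTheory.beta (p + j) q / ProbabilityTheory.beta p q *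
        ProbabilityTheory.betaPDFReal (p + j) q x := by
    intro x
    rw [ProbabilityTheory.betaPDFReal, ProbabilityTheory.betaPDFReal]
    split_ifs with h
    · have h1 := (ProbabilityTheory.beta_pos hp hq).ne'
      have h2 := (ProbabilityTheory.beta_pos hpj hq).ne'
      rw [show p + j - 1 = p - 1 + j by ring, Real.rpow_add_natCast h.1.ne']
      field_simp
    · simp
  simp only [e]
  rw [integral_const_mul, integral_betaPDFReal hpj hq, mul_one]

/-- The normalizing constant of the Jacobi weight. -/
def jacobiConst (a b : ℝ) : ℝ :=
  1 / (ProbabilityTheory.beta (a + 1) (b + 1) * 2 ^ a * 2 ^ b * 2)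

theorem jacobiConst_pos {a b : ℝ} (ha : -1 < a) (hb : -1 < b) : 0 < jacobiConst a b := by
  have := ProbabilityTheory.beta_pos (by linarith : 0 < a + 1) (by linarith : 0 < b + 1)
  exact one_div_pos.2 (by positivity)

theorem setIntegral_Iio_betaMeasure {a b r : ℝ} (ha : -1 < a) (hb : -1 < b)
    (hr : -1 ≤ r) (hr1 : r ≤ 1) (g : ℝ → ℝ) :
    ∫ x in Set.Iio ((1 - r) / 2), g x ∂ProbabilityTheory.betaMeasure (a + 1) (b + 1) =
      jacobiConst a b * ∫ t in r..1, g ((1 - t) / 2) * jacobiWeight a b t := by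
  have ha' : 0 < a + 1 := by linarith
  have hb' : 0 < b + 1 := by linarith
  set ρ := (1 - r) / 2 with hρ
  have hρ0 : 0 ≤ ρ := by rw [hρ]; linarith
  have hρ1 : ρ ≤ 1 := by rw [hρ]; linarith
  set B := ProbabilityTheory.beta (a + 1) (b + 1) with hB
  have hBpos : 0 < B := ProbabilityTheory.beta_pos ha' hb'
  have h1 : ∫ x in Set.Iio ρ, g x ∂ProbabilityTheory.betaMeasure (a + 1) (b + 1) =
      ∫ x in (0 : ℝ)..ρ, 1 / B * x ^ a * (1 - x) ^ b * g x := by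
    rw [ProbabilityTheory.betaMeasure, setIntegral_withDensity_eq_setIntegral_toReal_smul
      (measurable_betaPDF _ _) (ae_of_all _ fun _ => ENNReal.ofReal_lt_top) _ measurableSet_Iio]
    simp only [toReal_betaPDF ha' hb', smul_eq_mul]
    rw [intervalIntegral.integral_of_le hρ0, integral_Ioc_eq_integral_Ioo,
      ← Set.Iio_inter_Ioi, Set.inter_comm, setIntegral_eq_of_subset_of_forall_sdiff_eq_zero
        measurableSet_Iio (Set.inter_subset_right (s := Set.Ioi (0 : ℝ)))
        (f := fun x => ProbabilityTheory.betaPDFReal (a + 1) (b + 1) x * g x)]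
    · refine setIntegral_congr_fun (measurableSet_Ioi.inter measurableSet_Iio) fun x hx => ?_
      have h0 : (0 : ℝ) < x := hx.1
      have h1 : x < ρ := hx.2
      simp only [ProbabilityTheory.betaPDFReal, h0, h1.trans_le hρ1, and_self, if_true,
        add_sub_cancel_right, hB]
    · intro x hx
      have : ¬ 0 < x := fun h => hx.2 ⟨h, hx.1⟩
      simp [ProbabilityTheory.betaPDFReal, this]
  have h2 := intervalIntegral.integral_comp_sub_div (a := r) (b := 1)
    (fun x => 1 / B * x ^ a * (1 - x) ^ b * g x) two_ne_zero (1 / 2)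
  have h3 : ∫ t in r..1, (fun x => 1 / B * x ^ a * (1 - x) ^ b * g x) (1 / 2 - t / 2) =
      2 * jacobiConst a b * ∫ t in r..1, g ((1 - t) / 2) * jacobiWeight a b t := by
    rw [← intervalIntegral.integral_const_mul]
    refine intervalIntegral.integral_congr fun t ht => ?_
    rw [Set.uIcc_of_le hr1] at ht
    have e1 : 1 / 2 - t / 2 = (1 - t) / 2 := by ring
    have e2 : 1 - (1 - t) / 2 = (1 + t) / 2 := by ring
    simp only [e1, e2]
    rw [Real.div_rpow (by linarith [ht.2]) two_pos.le,
      Real.div_rpow (by linarith [ht.1]) two_pos.le, jacobiConst, jacobiWeight, ← hB]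
    have p1 : (0 : ℝ) < 2 ^ a := by positivity
    have p2 : (0 : ℝ) < 2 ^ b := by positivity
    field_simp
  rw [h3, show (1 : ℝ) / 2 - 1 / 2 = 0 by norm_num, show (1 : ℝ) / 2 - r / 2 = ρ by rw [hρ]; ring,
    smul_eq_mul, ← h1] at h2
  linarith

theorem integral_betaMeasure_eq_jacobi {a b : ℝ} (ha : -1 < a) (hb : -1 < b) (g : ℝ → ℝ) :
    ∫ x, g x ∂ProbabilityTheory.betaMeasure (a + 1) (b + 1) =
      jacobiConst a b * ∫ t in (-1 : ℝ)..1, g ((1 - t) / 2) * jacobiWeight a b t := by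
  rw [← setIntegral_Iio_betaMeasure ha hb le_rfl (by norm_num), ← setIntegral_univ]
  refine setIntegral_congr_set ?_
  have hne : ∀ᵐ x ∂ProbabilityTheory.betaMeasure (a + 1) (b + 1), x ≠ 1 := by
    rw [ae_iff]; simpa using betaMeasure_singleton (a + 1) (b + 1) 1
  filter_upwards [ae_betaMeasure_mem_Icc (a + 1) (b + 1), hne] with x hx hx1
  have h1 : x < (1 - -1) / 2 := by
    have := lt_of_le_of_ne hx.2 hx1
    linarith
  exact propext ⟨fun _ => h1, fun _ => trivial⟩

/-! ### Polynomials of the limit -/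

/-- The coefficients of the Jacobi polynomial, normalized to be `1` at `t = 1`, in the powers of
`(1 - t) / 2`. -/
def jacobiCoeff (a b : ℝ) (x j : ℕ) : ℝ :=
  poch (-(x : ℝ)) j * poch ((x : ℝ) + a + b + 1) j / (poch (a + 1) j * (j.factorial : ℝ))

/-- The Jacobi polynomial as a polynomial in `(1 - t) / 2`, normalized to be `1` at `t = 1`. -/
def shiftedJacobi (a b : ℝ) (x : ℕ) : Polynomial ℝ :=
  ∑ j ∈ Finset.range (x + 1), Polynomial.C (jacobiCoeff a b x j) * Polynomial.X ^ j

theorem eval_shiftedJacobi (a b : ℝ) (x : ℕ) (u : ℝ) :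
    (shiftedJacobi a b x).eval u = ∑ j ∈ Finset.range (x + 1), jacobiCoeff a b x j * u ^ j := by
  simp [shiftedJacobi, Polynomial.eval_finsetSum]

theorem jacobiPoly_eq (a b : ℝ) (x : ℕ) (t : ℝ) :
    jacobiPoly a b x t =
      poch (a + 1) x / (x.factorial : ℝ) * (shiftedJacobi a b x).eval ((1 - t) / 2) := by
  rw [eval_shiftedJacobi, jacobiPoly]
  rfl

theorem shiftedJacobi_ne_zero (a b : ℝ) (x : ℕ) : shiftedJacobi a b x ≠ 0 := by
  intro h
  have h1 : (shiftedJacobi a b x).eval 0 = 1 := by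
    rw [eval_shiftedJacobi, Finset.sum_range_succ']
    simp [jacobiCoeff, poch_zero]
  rw [h] at h1
  simp at h1

theorem integral_shiftedJacobi_sq_pos {a b : ℝ} (ha : -1 < a) (hb : -1 < b) (x : ℕ) :
    0 < ∫ u, (shiftedJacobi a b x).eval u * (shiftedJacobi a b x).eval u
      ∂ProbabilityTheory.betaMeasure (a + 1) (b + 1) := by
  have hprob := ProbabilityTheory.isProbabilityMeasureBeta (by linarith : 0 < a + 1)
    (by linarith : 0 < b + 1)
  set ν := ProbabilityTheory.betaMeasure (a + 1) (b + 1)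
  refine lt_of_le_of_ne (integral_nonneg fun u => mul_self_nonneg _) fun h => ?_
  have h0 := (integral_eq_zero_iff_of_nonneg (fun u => mul_self_nonneg _)
    (integrable_of_continuous_of_ae_mem_Icc (ae_betaMeasure_mem_Icc (a + 1) (b + 1))
      ((shiftedJacobi a b x).continuous.mul (shiftedJacobi a b x).continuous))).1 h.symm
  have hfin : (({u | (shiftedJacobi a b x).IsRoot u} : Set ℝ)).Finite :=
    Polynomial.finite_setOfPred_isRoot (shiftedJacobi_ne_zero a b x)
  have hnull : ν {u | (shiftedJacobi a b x).IsRoot u} = 0 :=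
    (withDensity_absolutelyContinuous _ _) (hfin.measure_zero volume)
  have huniv : ν Set.univ = 0 := by
    rw [← nonpos_iff_eq_zero, ← hnull]
    refine measure_mono_ae ?_
    filter_upwards [h0] with u hu _
    exact mul_self_eq_zero.1 hu
  simp at huniv

theorem discreteJacobiKernel_eq {r a b : ℝ} (ha : -1 < a) (hb : -1 < b) (hr : -1 ≤ r)
    (hr1 : r ≤ 1) (x y : ℕ) :
    discreteJacobiKernel r a b x y =
      (∫ u in Set.Iio ((1 - r) / 2), (shiftedJacobi a b x).eval u * (shiftedJacobi a b y).eval u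
        ∂ProbabilityTheory.betaMeasure (a + 1) (b + 1)) /
      (Real.sqrt (∫ u, (shiftedJacobi a b x).eval u * (shiftedJacobi a b x).eval u
        ∂ProbabilityTheory.betaMeasure (a + 1) (b + 1)) *
       Real.sqrt (∫ u, (shiftedJacobi a b y).eval u * (shiftedJacobi a b y).eval u
        ∂ProbabilityTheory.betaMeasure (a + 1) (b + 1))) := by
  have hZ := jacobiConst_pos ha hb
  have hc : ∀ x : ℕ, 0 < poch (a + 1) x / (x.factorial : ℝ) := fun x =>
    div_pos (poch_pos (by linarith) x) (by positivity)
  have norm : ∀ x : ℕ, jacobiNorm a b x = poch (a + 1) x / (x.factorial : ℝ) *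
      Real.sqrt (∫ u, (shiftedJacobi a b x).eval u * (shiftedJacobi a b x).eval u
        ∂ProbabilityTheory.betaMeasure (a + 1) (b + 1)) / Real.sqrt (jacobiConst a b) := by
    intro x
    rw [integral_betaMeasure_eq_jacobi ha hb
      (fun u => (shiftedJacobi a b x).eval u * (shiftedJacobi a b x).eval u),
      Real.sqrt_mul hZ.le, mul_div_assoc, mul_div_cancel_left₀ _ (Real.sqrt_pos.2 hZ).ne',
      jacobiNorm]
    refine Eq.trans ?_ (congrArg (· * _) (Real.sqrt_sq (hc x).le))
    rw [← Real.sqrt_mul (sq_nonneg _), ← intervalIntegral.integral_const_mul]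
    simp only [jacobiPoly_eq]
    congr 1
    refine intervalIntegral.integral_congr fun t _ => ?_
    ring
  have int : ∫ t in r..1, jacobiPoly a b x t * jacobiPoly a b y t * jacobiWeight a b t =
      poch (a + 1) x / (x.factorial : ℝ) * (poch (a + 1) y / (y.factorial : ℝ)) *
      ((∫ u in Set.Iio ((1 - r) / 2), (shiftedJacobi a b x).eval u * (shiftedJacobi a b y).eval u
        ∂ProbabilityTheory.betaMeasure (a + 1) (b + 1)) / jacobiConst a b) := by
    rw [setIntegral_Iio_betaMeasure ha hb hr hr1
      (fun u => (shiftedJacobi a b x).eval u * (shiftedJacobi a b y).eval u),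
      mul_div_cancel_left₀ _ hZ.ne', ← intervalIntegral.integral_const_mul]
    simp only [jacobiPoly_eq]
    refine intervalIntegral.integral_congr fun t _ => ?_
    ring
  rw [discreteJacobiKernel, norm, norm, int]
  have h1 := hc x
  have h2 := hc y
  have h3 := Real.sqrt_pos.2 (integral_shiftedJacobi_sq_pos ha hb x)
  have h4 := Real.sqrt_pos.2 (integral_shiftedJacobi_sq_pos ha hb y)
  have h5 := Real.sqrt_pos.2 hZ
  have h6 := Real.mul_self_sqrt hZ.le
  generalize poch (a + 1) x / (x.factorial : ℝ) = c at *
  generalize poch (a + 1) y / (y.factorial : ℝ) = d at *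
  generalize Real.sqrt (∫ u, (shiftedJacobi a b x).eval u * (shiftedJacobi a b x).eval u
        ∂ProbabilityTheory.betaMeasure (a + 1) (b + 1)) = A at *
  generalize Real.sqrt (∫ u, (shiftedJacobi a b y).eval u * (shiftedJacobi a b y).eval u
        ∂ProbabilityTheory.betaMeasure (a + 1) (b + 1)) = B at *
  generalize Real.sqrt (jacobiConst a b) = q at *
  rw [← h6]
  field_simp

/-! ### The spectral measure of the Racah difference operator -/

/-- The value at the `n`th point of the dual lattice of the deformation of the `j`th power. -/
def dualPow (M : ℕ) (a b c : ℝ) (j n : ℕ) : ℝ :=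
  poch (-(n : ℝ)) j * poch (n + a + c) j / (poch (-(M : ℝ)) j * poch (M + a + b + c + 1) j)

/-- The `n`th point of the dual lattice. -/
def dualPoint (M : ℕ) (a b c : ℝ) (n : ℕ) : ℝ :=
  n * (n + a + c) / (M * (M + a + b + c + 1))

theorem racahPoly_eq_sum_dualPow (M : ℕ) (a b c : ℝ) (n x : ℕ) :
    racahPoly (-(M : ℝ) - 1) (M + a + c) a b n x =
      ∑ j ∈ Finset.range (x + 1), jacobiCoeff a b x j * dualPow M a b c j n := by
  have e : ∀ j, poch (-(n : ℝ)) j * poch ((n : ℝ) + (-(M : ℝ) - 1) + (M + a + c) + 1) j *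
      poch (-(x : ℝ)) j * poch ((x : ℝ) + a + b + 1) j /
      (poch (-(M : ℝ) - 1 + 1) j * poch (M + a + c + b + 1) j * poch (a + 1) j *
        (j.factorial : ℝ)) = jacobiCoeff a b x j * dualPow M a b c j n := by
    intro j
    rw [jacobiCoeff, dualPow, div_mul_div_comm,
      show (n : ℝ) + (-(M : ℝ) - 1) + (M + a + c) + 1 = n + a + c by ring,
      show -(M : ℝ) - 1 + 1 = -M by ring, show (M : ℝ) + a + c + b + 1 = M + a + b + c + 1 by ring]
    congr 1 <;> ring
  rw [racahPoly]
  simp only [e]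
  have z : ∀ m, m = n ∨ m = x → ∑ j ∈ Finset.range (m + 1),
      jacobiCoeff a b x j * dualPow M a b c j n = ∑ j ∈ Finset.range (n + x + 1),
      jacobiCoeff a b x j * dualPow M a b c j n := by
    intro m hm
    refine Finset.sum_subset (fun j hj => ?_) fun j _ hj => ?_
    · rw [Finset.mem_range] at hj ⊢; omega
    · have hj : m < j := by rw [Finset.mem_range] at hj; omega
      rcases hm with rfl | rfl
      · rw [dualPow, poch_neg_eq_zero hj]; simp
      · rw [jacobiCoeff, poch_neg_eq_zero hj]; simp
  rw [z n (Or.inl rfl), z x (Or.inr rfl)]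

theorem sum_poch_telescope {A B : ℝ} (h : 0 < A + B + 1) (J : ℕ) :
    ∑ j ∈ Finset.range (J + 1), poch A j * poch B j / (poch (A + B + 1) j * (j.factorial : ℝ)) =
      poch (A + 1) J * poch (B + 1) J / (poch (A + B + 1) J * (J.factorial : ℝ)) := by
  induction J with
  | zero => simp [poch_zero]
  | succ J ih =>
    rw [Finset.sum_range_succ, ih, poch_succ_left A, poch_succ_left B, poch_succ (A + 1),
      poch_succ (B + 1), poch_succ (A + B + 1), Nat.factorial_succ]
    have h1 := (poch_pos h J).ne'
    have h2 : A + B + 1 + J ≠ 0 := by positivity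
    have h3 : (J : ℝ) + 1 ≠ 0 := by positivity
    have h4 : (J.factorial : ℝ) ≠ 0 := by positivity
    push_cast
    field_simp
    ring

theorem sum_jacobiCoeff_mul_moment {a b : ℝ} (ha : -1 < a) (hb : -1 < b) (x : ℕ) :
    ∑ j ∈ Finset.range (x + 1), jacobiCoeff a b x j * (poch (a + 1) j / poch (a + b + 2) j) =
      if x = 0 then 1 else 0 := by
  have e : ∀ j, jacobiCoeff a b x j * (poch (a + 1) j / poch (a + b + 2) j) =
      poch (-(x : ℝ)) j * poch (x + a + b + 1) j /
        (poch (-(x : ℝ) + (x + a + b + 1) + 1) j * (j.factorial : ℝ)) := by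
    intro j
    have h1 := (poch_pos (by linarith : 0 < a + 1) j).ne'
    rw [show -(x : ℝ) + (x + a + b + 1) + 1 = a + b + 2 by ring, jacobiCoeff]
    field_simp
  simp only [e]
  rw [sum_poch_telescope (by linarith)]
  split_ifs with hx
  · subst hx; simp [poch_zero]
  · obtain ⟨m, rfl⟩ := Nat.exists_eq_succ_of_ne_zero hx
    have : poch (-((m + 1 : ℕ) : ℝ) + 1) (m + 1) = 0 := by
      rw [show -((m + 1 : ℕ) : ℝ) + 1 = -(m : ℝ) by push_cast; ring]
      exact poch_neg_eq_zero (by omega)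
    rw [Nat.succ_eq_add_one, this]
    simp

theorem jacobiCoeff_self_ne_zero {a b : ℝ} (ha : -1 < a) (hb : -1 < b) (x : ℕ) :
    jacobiCoeff a b x x ≠ 0 := by
  refine div_ne_zero (mul_ne_zero (poch_ne_zero fun j hj => ?_) (poch_ne_zero fun j hj => ?_))
    (mul_ne_zero (poch_pos (by linarith) x).ne' (by positivity))
  · have : (j : ℝ) < x := by exact_mod_cast hj
    linarith
  · have : (1 : ℝ) ≤ x := by exact_mod_cast (by omega : 1 ≤ x)
    have hj0 : (0 : ℝ) ≤ j := j.cast_nonneg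
    linarith

section Dual

variable {a b c : ℝ} {M : ℕ}

/-- The weights of the spectral measure. -/
def dualWeight (M : ℕ) (a b c : ℝ) (n : ℕ) : ℝ :=
  (racahNormSq M (-(M : ℝ) - 1) (M + a + c) a b n)⁻¹

theorem dualWeight_nonneg (ha : -1 < a) (hb : -1 < b) (hc : 0 < c) (n : ℕ) :
    0 ≤ dualWeight M a b c n :=
  inv_nonneg.2 (zero_le_one.trans (one_le_racahNormSq ha hb hc n))

theorem sum_dualWeight_mul_racahPoly_mul (ha : -1 < a) (hb : -1 < b) (hc : 0 < c) {x y : ℕ}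
    (hx : x ≤ M) (hy : y ≤ M) :
    ∑ n ∈ Finset.range (M + 1), dualWeight M a b c n *
      (racahPoly (-(M : ℝ) - 1) (M + a + c) a b n x *
        racahPoly (-(M : ℝ) - 1) (M + a + c) a b n y) =
      if x = y then (racahWeight (-(M : ℝ) - 1) (M + a + c) a b x)⁻¹ else 0 := by
  rw [← sum_racahPoly_mul_racahPoly_div_normSq ha hb hc hx hy]
  exact Finset.sum_congr rfl fun n _ => by rw [dualWeight, div_eq_inv_mul]

theorem sum_dualWeight (ha : -1 < a) (hb : -1 < b) (hc : 0 < c) :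
    ∑ n ∈ Finset.range (M + 1), dualWeight M a b c n = 1 := by
  have := sum_dualWeight_mul_racahPoly_mul ha hb hc M.zero_le M.zero_le
  simpa [racahPoly_zero_right, racahWeight_zero] using this

theorem sum_dualWeight_mul_dualPow (ha : -1 < a) (hb : -1 < b) (hc : 0 < c) {j : ℕ} (hj : j ≤ M) :
    ∑ n ∈ Finset.range (M + 1), dualWeight M a b c n * dualPow M a b c j n =
      poch (a + 1) j / poch (a + b + 2) j := by
  induction j using Nat.strong_induction_on with
  | _ x ih =>
    have h1 := sum_dualWeight_mul_racahPoly_mul ha hb hc hj M.zero_le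
    have h2 := sum_jacobiCoeff_mul_moment ha hb x
    have h3 : (if x = 0 then (racahWeight (-(M : ℝ) - 1) (M + a + c) a b x)⁻¹ else 0) =
        if x = 0 then 1 else 0 := by
      split_ifs with h
      · rw [h, racahWeight_zero, inv_one]
      · rfl
    rw [h3, ← h2] at h1
    simp only [racahPoly_zero_right, mul_one, racahPoly_eq_sum_dualPow, Finset.mul_sum] at h1
    rw [Finset.sum_comm] at h1
    have e : ∀ j, ∑ n ∈ Finset.range (M + 1), dualWeight M a b c n *
        (jacobiCoeff a b x j * dualPow M a b c j n) =
        jacobiCoeff a b x j * ∑ n ∈ Finset.range (M + 1),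
          dualWeight M a b c n * dualPow M a b c j n := by
      intro j
      rw [Finset.mul_sum]
      exact Finset.sum_congr rfl fun n _ => by ring
    simp only [e] at h1
    rw [Finset.sum_range_succ _ x, Finset.sum_range_succ _ x, Finset.sum_congr rfl fun j hj' => by
      rw [ih j (Finset.mem_range.1 hj') ((Finset.mem_range.1 hj').le.trans hj)]] at h1
    exact mul_left_cancel₀ (jacobiCoeff_self_ne_zero ha hb x) (add_left_cancel h1)

theorem dualPoint_mem (ha : -1 < a) (hb : -1 < b) (hc : 0 < c) {n : ℕ} (hn : n ≤ M) :
    dualPoint M a b c n ∈ Set.Icc (0 : ℝ) 1 := by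
  rcases Nat.eq_zero_or_pos n with rfl | hn0
  · simp [dualPoint]
  have h1 : (1 : ℝ) ≤ n := by exact_mod_cast hn0
  have h2 : (n : ℝ) ≤ M := by exact_mod_cast hn
  have h3 : (0 : ℝ) < M * (M + a + b + c + 1) := mul_pos (by linarith) (by linarith)
  refine ⟨div_nonneg (mul_nonneg (by linarith) (by linarith)) h3.le, (div_le_one h3).2 ?_⟩
  exact mul_le_mul h2 (by linarith) (by linarith) (by linarith)

theorem dualPoint_mono (ha : -1 < a) (hb : -1 < b) (hc : 0 < c) (hM : 0 < M) {m n : ℕ}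
    (h : m ≤ n) : dualPoint M a b c m ≤ dualPoint M a b c n := by
  have hM' : (1 : ℝ) ≤ M := by exact_mod_cast hM
  have h3 : (0 : ℝ) < M * (M + a + b + c + 1) := mul_pos (by linarith) (by linarith)
  refine div_le_div_of_nonneg_right ?_ h3.le
  rcases h.eq_or_lt with rfl | h
  · exact le_rfl
  have h1 : (m : ℝ) + 1 ≤ n := by exact_mod_cast h
  have h2 : (0 : ℝ) ≤ m := m.cast_nonneg
  nlinarith

end Dual

/-! ### Uniform approximation -/

theorem tendsto_dualDen {M : ℕ → ℕ} (hM : Tendsto M atTop atTop) (d : ℝ) :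
    Tendsto (fun k => (M k : ℝ) * (M k + d)) atTop atTop := by
  have h1 : Tendsto (fun k => (M k : ℝ)) atTop atTop := tendsto_natCast_atTop_atTop.comp hM
  exact h1.atTop_mul_atTop₀ (tendsto_atTop_add_const_right _ d h1)

/-- `f k n - g k n` tends to zero uniformly in `n ≤ M k`. -/
def UniformlyClose (M : ℕ → ℕ) (f g : ℕ → ℕ → ℝ) : Prop :=
  ∀ ε > 0, ∀ᶠ k in atTop, ∀ n ≤ M k, |f k n - g k n| ≤ ε

theorem UniformlyClose.refl (M : ℕ → ℕ) (f : ℕ → ℕ → ℝ) : UniformlyClose M f f :=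
  fun ε hε => Eventually.of_forall fun k n _ => by simpa using hε.le

theorem UniformlyClose.add {M : ℕ → ℕ} {f g f' g' : ℕ → ℕ → ℝ} (h : UniformlyClose M f g)
    (h' : UniformlyClose M f' g') :
    UniformlyClose M (fun k n => f k n + f' k n) (fun k n => g k n + g' k n) := by
  intro ε hε
  filter_upwards [h (ε / 2) (half_pos hε), h' (ε / 2) (half_pos hε)] with k h1 h2 n hn
  rw [show f k n + f' k n - (g k n + g' k n) = (f k n - g k n) + (f' k n - g' k n) by ring]
  exact (abs_add_le _ _).trans (by linarith [h1 n hn, h2 n hn])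

theorem UniformlyClose.mul {M : ℕ → ℕ} {f g f' g' : ℕ → ℕ → ℝ} {C C' : ℝ}
    (h : UniformlyClose M f g) (h' : UniformlyClose M f' g')
    (hg : ∀ k, ∀ n ≤ M k, |g k n| ≤ C) (hg' : ∀ k, ∀ n ≤ M k, |g' k n| ≤ C') :
    UniformlyClose M (fun k n => f k n * f' k n) (fun k n => g k n * g' k n) := by
  have hC : 0 ≤ C := (abs_nonneg _).trans (hg 0 0 (Nat.zero_le _))
  have hC' : 0 ≤ C' := (abs_nonneg _).trans (hg' 0 0 (Nat.zero_le _))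
  intro ε hε
  have hη : 0 < min 1 (ε / (C + C' + 1)) := lt_min one_pos (by positivity)
  set η := min 1 (ε / (C + C' + 1))
  have hη1 : η ≤ 1 := min_le_left _ _
  have hη2 : η * (C + C' + 1) ≤ ε :=
    (le_div_iff₀ (by positivity)).1 (min_le_right _ _)
  filter_upwards [h η hη, h' η hη] with k h1 h2 n hn
  have h1 := h1 n hn
  have h2 := h2 n hn
  have e : f k n * f' k n - g k n * g' k n = (f k n - g k n) * (f' k n - g' k n) +
      (f k n - g k n) * g' k n + g k n * (f' k n - g' k n) := by ring
  rw [e]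
  refine ((abs_add_le _ _).trans (add_le_add_left (abs_add_le _ _) _)).trans ?_
  rw [abs_mul, abs_mul, abs_mul]
  have b1 : |f k n - g k n| * |f' k n - g' k n| ≤ η * 1 :=
    mul_le_mul h1 (h2.trans hη1) (abs_nonneg _) hη.le
  have b2 : |f k n - g k n| * |g' k n| ≤ η * C' :=
    mul_le_mul h1 (hg' k n hn) (abs_nonneg _) hη.le
  have b3 : |g k n| * |f' k n - g' k n| ≤ C * η :=
    mul_le_mul (hg k n hn) h2 (abs_nonneg _) hC
  nlinarith

theorem UniformlyClose.tendsto_sum {M : ℕ → ℕ} {f g : ℕ → ℕ → ℝ} (h : UniformlyClose M f g)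
    {w : ℕ → ℕ → ℝ} (hw : ∀ k, ∀ n ≤ M k, 0 ≤ w k n)
    (hw1 : ∀ k, ∑ n ∈ Finset.range (M k + 1), w k n = 1) {l : ℝ}
    (hg : Tendsto (fun k => ∑ n ∈ Finset.range (M k + 1), w k n * g k n) atTop (𝓝 l)) :
    Tendsto (fun k => ∑ n ∈ Finset.range (M k + 1), w k n * f k n) atTop (𝓝 l) := by
  refine tendsto_of_tendsto_of_dist hg (Metric.tendsto_nhds.2 fun ε hε => ?_)
  filter_upwards [h (ε / 2) (half_pos hε)] with k hk
  rw [Real.dist_0_eq_abs, abs_of_nonneg dist_nonneg, dist_comm, Real.dist_eq]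
  refine lt_of_le_of_lt (abs_sum_mul_sub_le (h := fun _ => ε / 2)
    (fun n hn => hw k n (Nat.lt_succ_iff.1 (Finset.mem_range.1 hn)))
    fun n hn => hk n (Nat.lt_succ_iff.1 (Finset.mem_range.1 hn))) ?_
  rw [← Finset.sum_mul, hw1, one_mul]
  exact half_lt_self hε

section

variable {a b c : ℝ} {M : ℕ → ℕ}

theorem uniformlyClose_dualPow (ha : -1 < a) (hb : -1 < b) (hc : 0 < c)
    (hM : Tendsto M atTop atTop) (j : ℕ) :
    UniformlyClose M (fun k => dualPow (M k) a b c j) (fun k n => dualPoint (M k) a b c n ^ j) := by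
  have hbd : ∀ k, ∀ n ≤ M k, |dualPoint (M k) a b c n| ≤ 1 := fun k n hn => by
    have := dualPoint_mem ha hb hc hn
    rw [abs_of_nonneg this.1]; exact this.2
  induction j with
  | zero =>
    have : (fun k => dualPow (M k) a b c 0) = fun k n => dualPoint (M k) a b c n ^ 0 := by
      ext k n; simp [dualPow, poch_zero]
    rw [this]
    exact UniformlyClose.refl _ _
  | succ j ih =>
    have key : UniformlyClose M
        (fun k n => (-(n : ℝ) + j) * (n + a + c + j) /
          ((-(M k : ℝ) + j) * (M k + a + b + c + 1 + j)))
        (fun k => dualPoint (M k) a b c) := by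
      intro ε hε
      set p : ℝ := j * (j + (a + c)) with hp
      set q : ℝ := j * (j + (a + b + c + 1)) with hq
      have hlim := tendsto_dualDen hM (a + b + c + 1)
      filter_upwards [hlim.eventually_gt_atTop 0, hlim.eventually_gt_atTop q,
        hlim.eventually_ge_atTop (q + (|q| + |p|) / ε)] with k h0 h1 h2 n hn
      have hu := dualPoint_mem ha hb hc hn
      set Λ : ℝ := (M k : ℝ) * (M k + (a + b + c + 1)) with hΛ
      have hnΛ : (n : ℝ) * (n + a + c) = dualPoint (M k) a b c n * Λ := by
        rw [dualPoint, show (M k : ℝ) * (M k + a + b + c + 1) = Λ by rw [hΛ]; ring,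
          div_mul_cancel₀ _ h0.ne']
      set u := dualPoint (M k) a b c n
      have e1 : (-(n : ℝ) + j) * (n + a + c + j) = -(u * Λ - p) := by
        rw [← hnΛ, hp]; ring
      have e2 : (-(M k : ℝ) + j) * (M k + a + b + c + 1 + j) = -(Λ - q) := by
        rw [hΛ, hq]; ring
      have h3 : 0 < Λ - q := sub_pos.2 h1
      have e3 : -(u * Λ - p) / -(Λ - q) - u = (u * q - p) / (Λ - q) := by
        rw [neg_div_neg_eq, div_sub' h3.ne']; congr 1; ring
      rw [e1, e2, e3, abs_div, abs_of_pos h3, div_le_iff₀ h3]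
      have h4 : (|q| + |p|) ≤ ε * (Λ - q) := by
        have : (|q| + |p|) / ε ≤ Λ - q := by linarith
        rw [div_le_iff₀ hε] at this
        linarith
      refine le_trans ?_ h4
      refine (abs_sub _ _).trans (add_le_add_left ?_ _)
      rw [abs_mul, abs_of_nonneg hu.1]
      exact mul_le_of_le_one_left (abs_nonneg _) hu.2
    have := ih.mul key (C := 1) (C' := 1) (fun k n hn => by
      rw [abs_pow]; exact pow_le_one₀ (abs_nonneg _) (hbd k n hn)) hbd
    convert this using 3 with k n
    · rw [dualPow, dualPow, div_mul_div_comm]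
      simp only [poch_succ]
      congr 1 <;> ring
    · exact pow_succ _ _

theorem uniformlyClose_racahPoly (ha : -1 < a) (hb : -1 < b) (hc : 0 < c)
    (hM : Tendsto M atTop atTop) (x : ℕ) :
    UniformlyClose M (fun k n => racahPoly (-(M k : ℝ) - 1) (M k + a + c) a b n x)
      (fun k n => (shiftedJacobi a b x).eval (dualPoint (M k) a b c n)) := by
  simp only [racahPoly_eq_sum_dualPow, eval_shiftedJacobi]
  generalize x + 1 = m
  induction m with
  | zero => simpa using UniformlyClose.refl M _
  | succ m ih =>
    simp only [Finset.sum_range_succ]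
    refine ih.add ?_
    refine UniformlyClose.mul (C := |jacobiCoeff a b x m|) (C' := 1)
      (UniformlyClose.refl M fun _ _ => jacobiCoeff a b x m)
      (uniformlyClose_dualPow ha hb hc hM m) (fun _ _ _ => le_rfl) fun k n hn => ?_
    have := dualPoint_mem ha hb hc hn
    rw [abs_pow, abs_of_nonneg this.1]
    exact pow_le_one₀ this.1 this.2

theorem uniformlyClose_racahPoly_mul (ha : -1 < a) (hb : -1 < b) (hc : 0 < c)
    (hM : Tendsto M atTop atTop) (x y : ℕ) :
    UniformlyClose M (fun k n => racahPoly (-(M k : ℝ) - 1) (M k + a + c) a b n x *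
        racahPoly (-(M k : ℝ) - 1) (M k + a + c) a b n y)
      (fun k n => (shiftedJacobi a b x).eval (dualPoint (M k) a b c n) *
        (shiftedJacobi a b y).eval (dualPoint (M k) a b c n)) := by
  have bd : ∀ x, ∃ C, ∀ k, ∀ n ≤ M k,
      |(shiftedJacobi a b x).eval (dualPoint (M k) a b c n)| ≤ C := by
    intro x
    obtain ⟨C, hC⟩ := isCompact_Icc.exists_bound_of_continuousOn (s := Set.Icc (0 : ℝ) 1)
      (shiftedJacobi a b x).continuous.continuousOn
    exact ⟨C, fun k n hn => hC _ (dualPoint_mem ha hb hc hn)⟩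
  obtain ⟨C, hC⟩ := bd x
  obtain ⟨C', hC'⟩ := bd y
  exact (uniformlyClose_racahPoly ha hb hc hM x).mul (uniformlyClose_racahPoly ha hb hc hM y)
    hC hC'

theorem tendsto_sum_dualPoint_pow (ha : -1 < a) (hb : -1 < b) (hc : 0 < c)
    (hM : Tendsto M atTop atTop) (j : ℕ) :
    Tendsto (fun k => ∑ n ∈ Finset.range (M k + 1),
      dualWeight (M k) a b c n * dualPoint (M k) a b c n ^ j) atTop
      (𝓝 (∫ x, x ^ j ∂ProbabilityTheory.betaMeasure (a + 1) (b + 1))) := by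
  rw [integral_pow_betaMeasure (by linarith) (by linarith)]
  refine UniformlyClose.tendsto_sum (g := fun k => dualPow (M k) a b c j) ?_
    (fun k n _ => dualWeight_nonneg ha hb hc n) (fun k => sum_dualWeight ha hb hc) ?_
  · intro ε hε
    filter_upwards [uniformlyClose_dualPow ha hb hc hM j ε hε] with k hk n hn
    rw [abs_sub_comm]
    exact hk n hn
  · refine tendsto_const_nhds.congr' ?_
    filter_upwards [hM.eventually_ge_atTop j] with k hk
    rw [sum_dualWeight_mul_dualPow ha hb hc hk, show a + 1 + (b + 1) = a + b + 2 by ring]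

end

/-! ### Convergence of the kernels -/

section

variable {a b c : ℝ} {M N : ℕ → ℕ}

theorem tendsto_racahWeight (ha : -1 < a) (hb : -1 < b) (hc : 0 < c)
    (hM : Tendsto M atTop atTop) (x : ℕ) :
    Tendsto (fun k => racahWeight (-(M k : ℝ) - 1) (M k + a + c) a b x) atTop
      (𝓝 (∫ u, (shiftedJacobi a b x).eval u * (shiftedJacobi a b x).eval u
        ∂ProbabilityTheory.betaMeasure (a + 1) (b + 1))⁻¹) := by
  have hprob := ProbabilityTheory.isProbabilityMeasureBeta (by linarith : 0 < a + 1)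
    (by linarith : 0 < b + 1)
  have h1 := tendsto_sum_continuous (ae_betaMeasure_mem_Icc (a + 1) (b + 1))
    (s := fun k => Finset.range (M k + 1))
    (w := fun k => dualWeight (M k) a b c) (u := fun k => dualPoint (M k) a b c)
    (fun k n _ => dualWeight_nonneg ha hb hc n) (fun k => sum_dualWeight ha hb hc)
    (fun k n hn => dualPoint_mem ha hb hc (Nat.lt_succ_iff.1 (Finset.mem_range.1 hn)))
    (tendsto_sum_dualPoint_pow ha hb hc hM)
    ((shiftedJacobi a b x).continuous.mul (shiftedJacobi a b x).continuous)
  have h2 := (uniformlyClose_racahPoly_mul ha hb hc hM x x).tendsto_sum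
    (fun k n _ => dualWeight_nonneg ha hb hc n) (fun k => sum_dualWeight ha hb hc) h1
  refine (h2.inv₀ (integral_shiftedJacobi_sq_pos ha hb x).ne').congr' ?_
  filter_upwards [hM.eventually_ge_atTop x] with k hk
  rw [sum_dualWeight_mul_racahPoly_mul ha hb hc hk hk, if_pos rfl, inv_inv]

theorem eventually_le_of_tendsto_div {σ : ℝ} (hσ : σ < 1) (hM : Tendsto M atTop atTop)
    (hNM : Tendsto (fun k => (N k : ℝ) / (M k : ℝ)) atTop (𝓝 σ)) : ∀ᶠ k in atTop, N k ≤ M k := by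
  filter_upwards [hNM.eventually (gt_mem_nhds hσ), hM.eventually_gt_atTop 0] with k h1 h2
  have h2' : (0 : ℝ) < M k := by exact_mod_cast h2
  rw [div_lt_one h2'] at h1
  exact_mod_cast h1.le

theorem tendsto_dualPoint {σ : ℝ} (hM : Tendsto M atTop atTop)
    (hNM : Tendsto (fun k => (N k : ℝ) / (M k : ℝ)) atTop (𝓝 σ)) :
    Tendsto (fun k => dualPoint (M k) a b c (N k)) atTop (𝓝 (σ * σ)) := by
  have hM' : Tendsto (fun k => (M k : ℝ)) atTop atTop := tendsto_natCast_atTop_atTop.comp hM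
  have h0 : ∀ d : ℝ, Tendsto (fun k => d / (M k : ℝ)) atTop (𝓝 0) := fun d =>
    hM'.const_div_atTop d
  have := (hNM.mul (hNM.add (h0 (a + c)))).div ((h0 (a + b + c + 1)).const_add 1) (by norm_num)
  simp only [add_zero, div_one] at this
  refine this.congr' ?_
  filter_upwards [hM'.eventually_gt_atTop 0] with k hk
  simp only [Pi.div_apply]
  rw [dualPoint, ← add_div, div_mul_div_comm, one_add_div hk.ne', div_div_div_eq,
    show (M k : ℝ) * M k * (M k + (a + b + c + 1)) = M k * (M k + a + b + c + 1) * M k by ring,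
    mul_div_mul_right _ _ hk.ne', ← add_assoc]

theorem tendsto_racahKernel {r : ℝ} (ha : -1 < a) (hb : -1 < b) (hr : r ∈ Set.Ioo (-1 : ℝ) 1)
    (hc : 0 < c) (hM : Tendsto M atTop atTop)
    (hNM : Tendsto (fun k => (N k : ℝ) / (M k : ℝ)) atTop (𝓝 (Real.sqrt ((1 - r) / 2))))
    (hle : ∀ᶠ k in atTop, N k ≤ M k) (x y : ℕ) :
    Tendsto (fun k => racahKernel (N k) (M k) (-(M k : ℝ) - 1) (M k + a + c) a b x y) atTop
      (𝓝 (discreteJacobiKernel r a b x y)) := by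
  have hprob := ProbabilityTheory.isProbabilityMeasureBeta (by linarith : 0 < a + 1)
    (by linarith : 0 < b + 1)
  have hρ : 0 ≤ (1 - r) / 2 := by linarith [hr.2]
  have ht : Tendsto (fun k => dualPoint (M k) a b c (N k)) atTop (𝓝 ((1 - r) / 2)) := by
    have := tendsto_dualPoint (a := a) (b := b) (c := c) hM hNM
    rwa [Real.mul_self_sqrt hρ] at this
  have h1 := tendsto_sum_truncated (ae_betaMeasure_mem_Icc (a + 1) (b + 1))
    (s := fun k => Finset.range (M k + 1))
    (w := fun k => dualWeight (M k) a b c) (u := fun k => dualPoint (M k) a b c)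
    (fun k n _ => dualWeight_nonneg ha hb hc n) (fun k => sum_dualWeight ha hb hc)
    (fun k n hn => dualPoint_mem ha hb hc (Nat.lt_succ_iff.1 (Finset.mem_range.1 hn)))
    (tendsto_sum_dualPoint_pow ha hb hc hM) (N := N)
    (betaMeasure_singleton (a + 1) (b + 1) ((1 - r) / 2)) ht
    (by
      filter_upwards [hM.eventually_gt_atTop 0] with k hk n _ hn
      exact dualPoint_mono ha hb hc hk hn.le)
    (by
      filter_upwards [hM.eventually_gt_atTop 0] with k hk n _ hn
      exact dualPoint_mono ha hb hc hk hn)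
    ((shiftedJacobi a b x).continuous.mul (shiftedJacobi a b y).continuous)
  have hclose : UniformlyClose M
      (fun k n => if n < N k then racahPoly (-(M k : ℝ) - 1) (M k + a + c) a b n x *
        racahPoly (-(M k : ℝ) - 1) (M k + a + c) a b n y else 0)
      (fun k n => if n < N k then (shiftedJacobi a b x).eval (dualPoint (M k) a b c n) *
        (shiftedJacobi a b y).eval (dualPoint (M k) a b c n) else 0) := by
    intro ε hε
    filter_upwards [uniformlyClose_racahPoly_mul ha hb hc hM x y ε hε] with k hk n hn
    split_ifs
    · exact hk n hn
    · simpa using hε.le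
  have h2 := hclose.tendsto_sum
    (fun k n _ => dualWeight_nonneg ha hb hc n) (fun k => sum_dualWeight ha hb hc) h1
  have h3 := (((tendsto_racahWeight ha hb hc hM x).mul
    (tendsto_racahWeight ha hb hc hM y)).sqrt).mul h2
  have hA := integral_shiftedJacobi_sq_pos ha hb x
  rw [discreteJacobiKernel_eq ha hb hr.1.le hr.2.le, div_eq_inv_mul, mul_inv, ← Real.sqrt_inv,
    ← Real.sqrt_inv, ← Real.sqrt_mul (inv_pos.2 hA).le]
  refine h3.congr' ?_
  filter_upwards [hM.eventually_ge_atTop x, hM.eventually_ge_atTop y, hle] with k hx hy hk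
  rw [racahKernel, if_pos ⟨hx, hy⟩]
  congr 1
  simp only [mul_ite, mul_zero]
  rw [← Finset.sum_filter]
  refine Finset.sum_congr ?_ fun n _ => ?_
  · ext n
    simp only [Finset.mem_filter, Finset.mem_range]
    omega
  · rw [dualWeight, div_eq_inv_mul]

end

end

theorem mainTheorem12 (a b r c : ℝ) (ha : -1 < a) (hb : -1 < b) (hr : r ∈ Set.Ioo (-1 : ℝ) 1)
    (hc : 0 < c) (N M : ℕ → ℕ) (hN : Tendsto N atTop atTop) (hM : Tendsto M atTop atTop)
    (hNM : Tendsto (fun k => (N k : ℝ) / (M k : ℝ)) atTop (𝓝 (Real.sqrt ((1 - r) / 2)))) :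
    -- the limiting ensemble exists and is unique
    (∃! Q : ProbabilityMeasure Conf, IsDiscreteJacobiEnsemble r a b Q) ∧
    -- the Racah ensembles exist and are unique whenever `N ≤ M`, hence for all large indices
    (∀ k, N k ≤ M k →
      ∃! P : ProbabilityMeasure Conf, IsRacahEnsemble (N k) (M k) ((M k : ℝ) + a + c) a b P) ∧
    (∀ᶠ k in atTop, N k ≤ M k) ∧
    -- weak convergence of the Racah ensembles to the discrete Jacobi ensemble
    ∀ (P : ℕ → ProbabilityMeasure Conf) (Q : ProbabilityMeasure Conf),
      (∀ᶠ k in atTop, IsRacahEnsemble (N k) (M k) ((M k : ℝ) + a + c) a b (P k)) →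
      IsDiscreteJacobiEnsemble r a b Q →
      Tendsto P atTop (𝓝 Q) := by
  have hle : ∀ᶠ k in atTop, N k ≤ M k := by
    refine eventually_le_of_tendsto_div ?_ hM hNM
    rw [Real.sqrt_lt' one_pos]
    linarith [hr.1]
  have hk := tendsto_racahKernel ha hb hr hc hM hNM hle
  refine ⟨?_, fun k hk => ?_, hle, fun P Q hP hQ => IsDeterminantal.tendsto hk hP hQ⟩
  · obtain ⟨Q, hQ⟩ := exists_isDeterminantal_of_tendsto hk
      (hle.mono fun k hk => exists_isRacahEnsemble ha hb hc hk)
    exact ⟨Q, hQ, fun Q' hQ' => IsDeterminantal.eq hQ' hQ⟩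
  · obtain ⟨P, hP⟩ := exists_isRacahEnsemble ha hb hc hk
    exact ⟨P, hP, fun P' hP' => IsDeterminantal.eq hP' hP⟩
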